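/- Let $n\ge 0$ and let $K,L\subset\mathbb R^n$ be convex bodies (compact convex sets with non-empty interior) both containing the origin. Write $|\cdot|$ for Lebesgue measure on $\mathbb R^n$, $A^\circ=\{y\in\mathbb R^n:\langle x,y\rangle\le 1\text{ for all }x\in A\}$ for the polar of a set $A\subset\mathbb R^n$, $-L=\{-x:x\in L\}$, $\frac{A+B}{2}=\{\frac{a+b}{2}:a\in A,\ b\in B\}$, and $\mathrm{conv}\{K,-L\}$ for the convex hull of $K\cup(-L)$. Then $$ |K\cap L|\,|\mathrm{conv}\{K,-L\}|\;\le\;\left|\left(\frac{K^\circ+L^\circ}{2}\right)^{\!\circ}\right|\,|\mathrm{conv}\{K,-L\}|\;\le\;2^n|K|\,|L| . $$ This strengthens the Rogers--Shephard inequality $|K\cap L|\,|\mathrm{conv}\{K,-L\}|\le 2^n|K|\,|L|$. Moreover, equality $$ |K\cap L|\,|\mathrm{conv}\{K,-L\}| = 2^n|K|\,|L| $$ holds if and only if $K=L$ and $K$ is an $n$-dimensional simplex having the origin as one of its vertices. -/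

import Mathlib

open MeasureTheory
open scoped Pointwise

/-- The polar set `K° = {y : ⟨x, y⟩ ≤ 1 for all x ∈ K}` of a subset `K` of `ℝⁿ`
(one-sided, without absolute value). -/
def polarSet {n : ℕ} (K : Set (EuclideanSpace ℝ (Fin n))) : Set (EuclideanSpace ℝ (Fin n)) :=
  {y | ∀ x ∈ K, inner ℝ x y ≤ 1}

/-- `K` is an `n`-dimensional simplex in `ℝⁿ` (the convex hull of `n + 1` affinely independent
points), and the origin is one of its vertices. -/
def IsSimplexWithVertexZero {n : ℕ} (K : Set (EuclideanSpace ℝ (Fin n))) : Prop :=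
  ∃ s : Affine.Simplex ℝ (EuclideanSpace ℝ (Fin n)) n,
    K = convexHull ℝ (Set.range s.points) ∧ ∃ i, s.points i = 0

/-! Let `A = conv(K ∪ -L)`, let `F(z)` be the volume in dimension `n + 1` of `joinFiber K L 1 z`,
and let `B = ∫ sⁿ(1 - s)ⁿ ds` over `(0, 1)`. Tonelli gives `∫ F ≤ B |K| |L|`. Fibres are
superadditive (`joinFiber_add`) and the fibre of height `r` over `z` is nonempty exactly when `z ∈ r
• A`, so `F(z) ≥ (1 - r)ⁿ⁺¹ F(0)` with `r` the gauge of `z` in `A`. Integrating over `A` gives `(n +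
1) B F(0) |A| ≤ ∫ F`. Finally `(n + 1) F(0) ≥ |M|`, where `M` is the projection to `ℝⁿ` of the fibre
over `0`, and `2 • M` is the polar of `(K° + L°)/2` (`polarSet_half_add_eq`). Cancelling `B` gives
the upper bound; `K ∩ L ⊆ 2 • M` gives the lower one.

If equality holds, the bound on `F` is sharp almost everywhere, then wherever the gauge is below
`1`. The inclusion of a translated fibre behind it is therefore an equality of sets (`FiberRigid`).
This rigidity, together with `2 • M = K ∩ L`, forces `K = L`. For `K = L` it makes the cone over `K`
a pointed lattice cone, in which Riesz decomposition makes the nonzero extreme points of `K`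
linearly independent; so `K` is a simplex with vertex `0`. Conversely, for such a simplex `conv(K ∪
-K)` contains `2ⁿ` essentially disjoint reflected copies of `K`. -/

/-! ### Fibres of the join of `K` and `-L`, and their convexity and compactness. -/

section Geometry

variable {E : Type*} [NormedAddCommGroup E] [NormedSpace ℝ E]

/-- The set of pairs `(s, x)` with `0 ≤ s ≤ h`, `x ∈ s • K` and `x - z ∈ (h - s) • L`. -/
def joinFiber (K L : Set E) (h : ℝ) (z : E) : Set (ℝ × E) :=
  {p | 0 ≤ p.1 ∧ p.1 ≤ h ∧ p.2 ∈ p.1 • K ∧ p.2 - z ∈ (h - p.1) • L}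

theorem add_mem_add_smul {K : Set E} (hK : Convex ℝ K) {a b : ℝ} (ha : 0 ≤ a) (hb : 0 ≤ b)
    {x y : E} (hx : x ∈ a • K) (hy : y ∈ b • K) : x + y ∈ (a + b) • K := by
  rw [hK.add_smul ha hb]
  exact Set.add_mem_add hx hy

theorem mem_smul_of_le {K : Set E} (hK : Convex ℝ K) (h0 : (0 : E) ∈ K) {a b : ℝ} (ha : 0 ≤ a)
    (hab : a ≤ b) {x : E} (hx : x ∈ a • K) : x ∈ b • K := by
  have h := add_mem_add_smul hK ha (sub_nonneg.2 hab) hx (Set.smul_mem_smul_set (a := b - a) h0)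
  simpa using h

theorem smul_mem_mul_smul {K : Set E} (c : ℝ) {a : ℝ} {x : E} (hx : x ∈ a • K) :
    c • x ∈ (c * a) • K := by
  rw [mul_smul]
  exact Set.smul_mem_smul_set hx

theorem eq_zero_of_mem_zero_smul {K : Set E} {x : E} (hx : x ∈ (0 : ℝ) • K) : x = 0 := by
  obtain ⟨y, -, rfl⟩ := hx
  simp

/-- Convexity gives `aK + bK = (a + b)K`. This superadditivity drives both the volume bound and its
equality case. -/
theorem joinFiber_add {K L : Set E} (hK : Convex ℝ K) (hL : Convex ℝ L) {h h' : ℝ} {z z' : E}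
    {p p' : ℝ × E} (hp : p ∈ joinFiber K L h z) (hp' : p' ∈ joinFiber K L h' z') :
    p + p' ∈ joinFiber K L (h + h') (z + z') := by
  obtain ⟨h1, h2, h3, h4⟩ := hp
  obtain ⟨h1', h2', h3', h4'⟩ := hp'
  refine ⟨add_nonneg h1 h1', add_le_add h2 h2', add_mem_add_smul hK h1 h1' h3 h3', ?_⟩
  have := add_mem_add_smul hL (sub_nonneg.2 h2) (sub_nonneg.2 h2') h4 h4'
  convert this using 2 <;> simp only [Prod.fst_add, Prod.snd_add]
  · ring
  · abel

theorem smul_mem_joinFiber {K L : Set E} {h : ℝ} {z : E} {p : ℝ × E} {c : ℝ} (hc : 0 ≤ c)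
    (hp : p ∈ joinFiber K L h z) : c • p ∈ joinFiber K L (c * h) (c • z) := by
  obtain ⟨h1, h2, h3, h4⟩ := hp
  refine ⟨mul_nonneg hc h1, mul_le_mul_of_nonneg_left h2 hc, smul_mem_mul_smul c h3, ?_⟩
  have := smul_mem_mul_smul c h4
  convert this using 2 <;> simp only [Prod.smul_fst, Prod.smul_snd, smul_eq_mul]
  · ring
  · rw [smul_sub]

theorem joinFiber_smul (K L : Set E) (h : ℝ) (z : E) {c : ℝ} (hc : 0 < c) :
    joinFiber K L (c * h) (c • z) = c • joinFiber K L h z := by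
  ext p
  rw [Set.mem_smul_set_iff_inv_smul_mem₀ hc.ne']
  constructor
  · intro hp
    have := smul_mem_joinFiber (inv_nonneg.2 hc.le) hp
    rwa [inv_mul_cancel_left₀ hc.ne', inv_smul_smul₀ hc.ne'] at this
  · intro hp
    have := smul_mem_joinFiber hc.le hp
    rwa [smul_inv_smul₀ hc.ne'] at this

theorem convex_joinFiber {K L : Set E} (hK : Convex ℝ K) (hL : Convex ℝ L) (h : ℝ) (z : E) :
    Convex ℝ (joinFiber K L h z) := by
  intro p hp q hq a b ha hb hab
  have := joinFiber_add hK hL (smul_mem_joinFiber ha hp) (smul_mem_joinFiber hb hq)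
  rwa [← add_mul, ← add_smul, hab, one_mul, one_smul] at this

theorem mem_convexHull_union_neg {K L : Set E} (hK : Convex ℝ K) (hL : Convex ℝ L)
    (hK0 : (0 : E) ∈ K) (hL0 : (0 : E) ∈ L) {z : E} :
    z ∈ convexHull ℝ (K ∪ -L) ↔ (joinFiber K L 1 z).Nonempty := by
  rw [convexHull_union ⟨0, hK0⟩ ⟨0, by simpa using hL0⟩, hK.convexHull_eq, hL.neg.convexHull_eq,
    mem_convexJoin]
  constructor
  · rintro ⟨a, ha, b, hb, s, t, hs, ht, hst, rfl⟩
    refine ⟨(s, s • a), hs, by simp only; linarith, Set.smul_mem_smul_set ha, ?_⟩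
    have : s • a - (s • a + t • b) = (1 - s) • (-b) := by
      rw [show 1 - s = t by linarith]
      simp
    rw [this]
    exact Set.smul_mem_smul_set hb
  · rintro ⟨⟨s, x⟩, h1, h2, ⟨a, ha, hax⟩, b, hb, hbx⟩
    simp only at h1 h2 hax hbx
    refine ⟨a, ha, -b, by simpa using hb, s, 1 - s, h1, sub_nonneg.2 h2, by ring, ?_⟩
    rw [smul_neg, hax, hbx]
    abel

/-- A point of the fibre is a splitting `z = x - y` with `x ∈ s • K` and `y ∈ (r - s) • L`, so
fibres record how `z` arises in `r • conv(K ∪ -L)`. -/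
theorem mem_smul_convexHull_union_neg {K L : Set E} (hK : Convex ℝ K) (hL : Convex ℝ L)
    (hK0 : (0 : E) ∈ K) (hL0 : (0 : E) ∈ L) {z : E} {r : ℝ} (hr : 0 ≤ r) :
    z ∈ r • convexHull ℝ (K ∪ -L) ↔ (joinFiber K L r z).Nonempty := by
  rcases hr.eq_or_lt with rfl | hr
  · constructor
    · intro hz
      rw [eq_zero_of_mem_zero_smul hz]
      exact ⟨0, le_rfl, le_rfl, ⟨0, hK0, by simp⟩, ⟨0, hL0, by simp⟩⟩
    · rintro ⟨⟨s, x⟩, h1, h2, h3, h4⟩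
      simp only at h1 h2 h3 h4
      obtain rfl : s = 0 := le_antisymm h2 h1
      rw [eq_zero_of_mem_zero_smul h3, sub_zero, zero_sub] at h4
      rw [neg_eq_zero.1 (eq_zero_of_mem_zero_smul h4)]
      exact ⟨0, subset_convexHull ℝ _ (Or.inl hK0), by simp⟩
  · rw [Set.mem_smul_set_iff_inv_smul_mem₀ hr.ne', mem_convexHull_union_neg hK hL hK0 hL0]
    have := joinFiber_smul K L 1 (r⁻¹ • z) hr
    rw [mul_one, smul_inv_smul₀ hr.ne'] at this
    rw [this, Set.smul_set_nonempty]

theorem isCompact_joinTotal {K L : Set E} (hK : IsCompact K) (hL : IsCompact L) :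
    IsCompact {q : E × (ℝ × E) | q.2 ∈ joinFiber K L 1 q.1} := by
  have : {q : E × (ℝ × E) | q.2 ∈ joinFiber K L 1 q.1} =
      (fun t : ℝ × (E × E) => (t.1 • t.2.1 - (1 - t.1) • t.2.2, (t.1, t.1 • t.2.1))) ''
        (Set.Icc 0 1 ×ˢ (K ×ˢ L)) := by
    ext ⟨z, s, x⟩
    constructor
    · rintro ⟨h1, h2, ⟨a, ha, hax⟩, b, hb, hbx⟩
      simp only at h1 h2 hax hbx
      refine ⟨(s, a, b), ⟨⟨h1, h2⟩, ha, hb⟩, ?_⟩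
      simp [hax, hbx]
    · rintro ⟨⟨t, a, b⟩, ⟨⟨h1, h2⟩, ha, hb⟩, h⟩
      simp only [Prod.mk.injEq] at h
      obtain ⟨rfl, rfl, rfl⟩ := h
      exact ⟨h1, h2, Set.smul_mem_smul_set ha, ⟨b, hb, by simp⟩⟩
  rw [this]
  exact (isCompact_Icc.prod (hK.prod hL)).image (by fun_prop)

theorem isCompact_joinFiber_one {K L : Set E} (hK : IsCompact K) (hL : IsCompact L) (z : E) :
    IsCompact (joinFiber K L 1 z) := by
  have h : IsCompact ({q : E × (ℝ × E) | q.2 ∈ joinFiber K L 1 q.1} ∩ {q | q.1 = z}) :=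
    (isCompact_joinTotal hK hL).inter_right (isClosed_singleton.preimage continuous_fst)
  convert h.image continuous_snd using 1
  ext p
  constructor
  · intro hp
    exact ⟨(z, p), ⟨hp, rfl⟩, rfl⟩
  · rintro ⟨⟨z', p'⟩, ⟨hp, rfl⟩, rfl⟩
    exact hp

theorem isCompact_joinFiber {K L : Set E} (hK : IsCompact K) (hL : IsCompact L) {h : ℝ}
    (hh : 0 < h) (z : E) : IsCompact (joinFiber K L h z) := by
  have := joinFiber_smul K L 1 (h⁻¹ • z) hh
  rw [mul_one, smul_inv_smul₀ hh.ne'] at this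
  rw [this]
  exact (isCompact_joinFiber_one hK hL _).smul h

theorem isCompact_convexHull_union_neg {K L : Set E} (hK : IsCompact K) (hL : IsCompact L)
    (hKc : Convex ℝ K) (hLc : Convex ℝ L) (hK0 : (0 : E) ∈ K) (hL0 : (0 : E) ∈ L) :
    IsCompact (convexHull ℝ (K ∪ -L)) := by
  convert (isCompact_joinTotal hK hL).image continuous_fst using 1
  ext z
  rw [mem_convexHull_union_neg hKc hLc hK0 hL0]
  constructor
  · rintro ⟨p, hp⟩
    exact ⟨(z, p), hp, rfl⟩
  · rintro ⟨⟨z, p⟩, hp, rfl⟩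
    exact ⟨p, hp⟩

/-- The gauge is attained, by compactness. This works even when `A` is not a neighbourhood of `0`,
as for `K` and `L` with `0` on the boundary. -/
theorem exists_least_mem_smul {A : Set E} (hA : IsCompact A) {x : E} {R : ℝ} (hR : 0 ≤ R)
    (hx : x ∈ R • A) :
    ∃ r : ℝ, 0 ≤ r ∧ x ∈ r • A ∧ ∀ r' : ℝ, 0 ≤ r' → x ∈ r' • A → r ≤ r' := by
  have hc : IsCompact ((fun t : ℝ × E => (t.1, t.1 • t.2)) '' (Set.Icc 0 R ×ˢ A)) :=
    (isCompact_Icc.prod hA).image (by fun_prop)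
  have hc' := (hc.inter_right (isClosed_singleton (x := x).preimage continuous_snd)).image
    continuous_fst
  obtain ⟨r, ⟨⟨r', y⟩, ⟨⟨⟨t, a⟩, ⟨⟨ht0, htR⟩, ha⟩, hta⟩, hy⟩, rfl⟩, hmin⟩ := hc'.exists_isLeast <| by
    obtain ⟨a, ha, rfl⟩ := hx
    exact ⟨R, (R, R • a), ⟨⟨(R, a), ⟨⟨hR, le_rfl⟩, ha⟩, rfl⟩, rfl⟩, rfl⟩
  simp only [Set.mem_preimage, Set.mem_singleton_iff, Prod.mk.injEq] at hta hy ht0 htR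
  obtain ⟨rfl, rfl⟩ := hta
  subst hy
  refine ⟨t, ht0, Set.smul_mem_smul_set ha, fun r' hr' hx' => ?_⟩
  by_cases hle : r' ≤ R
  · obtain ⟨b, hb, hbx⟩ := hx'
    exact hmin ⟨(r', t • a), ⟨⟨(r', b), ⟨⟨hr', hle⟩, hb⟩, by simpa using hbx⟩, rfl⟩, rfl⟩
  · exact htR.trans (not_le.1 hle).le

end Geometry

/-! ### The polar of the mean of two polars. -/

section PolarSum

variable {n : ℕ}

theorem mem_of_forall_polarSet_le {K : Set (EuclideanSpace ℝ (Fin n))} (hK : Convex ℝ K)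
    (hc : IsClosed K) (h0 : 0 ∈ K) {x : EuclideanSpace ℝ (Fin n)}
    (hx : ∀ y ∈ polarSet K, inner ℝ y x ≤ 1) : x ∈ K := by
  by_contra hxK
  obtain ⟨f, u, hf, hu⟩ := geometric_hahn_banach_closed_point hK hc hxK
  have hu0 : 0 < u := by simpa using hf 0 h0
  set v := (InnerProductSpace.toDual ℝ (EuclideanSpace ℝ (Fin n))).symm f with hv
  have hfv (a) : inner ℝ v a = f a := InnerProductSpace.toDual_symm_apply
  have h1 : u⁻¹ • v ∈ polarSet K := by
    intro a ha
    rw [inner_smul_right, real_inner_comm, hfv, inv_mul_le_iff₀ hu0, mul_one]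
    exact (hf a ha).le
  have h2 := hx _ h1
  rw [real_inner_smul_left, hfv, inv_mul_le_iff₀ hu0, mul_one] at h2
  exact absurd hu (not_lt.2 h2)

/-- The bipolar argument needs a positive dilation factor; `s = 0` is reached by applying it to all
positive `t ≥ s` and taking the least factor. -/
theorem mem_smul_of_forall_polarSet_le {K : Set (EuclideanSpace ℝ (Fin n))} (hK : Convex ℝ K)
    (hc : IsCompact K) (h0 : 0 ∈ K) {x : EuclideanSpace ℝ (Fin n)} {s : ℝ}
    (hx : ∀ y ∈ polarSet K, inner ℝ y x ≤ s) : x ∈ s • K := by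
  have hs : 0 ≤ s := by simpa using hx 0 (by simp [polarSet])
  have key (t : ℝ) (ht : 0 < t) (hst : s ≤ t) : x ∈ t • K := by
    rw [Set.mem_smul_set_iff_inv_smul_mem₀ ht.ne']
    refine mem_of_forall_polarSet_le hK hc.isClosed h0 fun y hy => ?_
    rw [inner_smul_right, inv_mul_le_iff₀ ht, mul_one]
    exact (hx y hy).trans hst
  obtain ⟨r, hr, hxr, hmin⟩ := exists_least_mem_smul hc (by positivity) (key (s + 1) (by positivity)
    (by linarith))
  have hrs : r ≤ s := by
    refine le_of_forall_pos_le_add fun ε hε => hmin _ (by positivity) (key _ (by positivity) ?_)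
    linarith
  exact mem_smul_of_le hK h0 hr hrs hxr

/-- The condition `⟨p, x⟩ + ⟨q, x⟩ ≤ 2` for all `p`, `q` separates: with `s` the supremum of `⟨p,
x⟩` over `K°`, the bipolar theorem gives `x ∈ s • K` and `x ∈ (2 - s) • L`. -/
theorem polarSet_half_add_eq {K L : Set (EuclideanSpace ℝ (Fin n))} (hK : Convex ℝ K)
    (hL : Convex ℝ L) (hKc : IsCompact K) (hLc : IsCompact L) (hK0 : 0 ∈ K) (hL0 : 0 ∈ L) :
    polarSet ((2⁻¹ : ℝ) • (polarSet K + polarSet L)) = Prod.snd '' joinFiber K L 2 0 := by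
  ext x
  constructor
  · intro hx
    have hx' (p) (hp : p ∈ polarSet K) (q) (hq : q ∈ polarSet L) :
        inner ℝ p x + inner ℝ q x ≤ 2 := by
      have := hx _ (Set.smul_mem_smul_set (Set.add_mem_add hp hq))
      rw [real_inner_smul_left, inner_add_left] at this
      linarith
    have hz (M : Set (EuclideanSpace ℝ (Fin n))) : 0 ∈ polarSet M := by simp [polarSet]
    set S := (fun p => inner ℝ p x) '' polarSet K with hS
    have hne : S.Nonempty := ⟨_, 0, hz K, rfl⟩
    have hbdd : BddAbove S := by
      refine ⟨2, ?_⟩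
      rintro _ ⟨p, hp, rfl⟩
      simpa using hx' p hp 0 (hz L)
    have h1 (p) (hp : p ∈ polarSet K) : inner ℝ p x ≤ sSup S := le_csSup hbdd ⟨p, hp, rfl⟩
    have h2 (q) (hq : q ∈ polarSet L) : inner ℝ q x ≤ 2 - sSup S := by
      have : sSup S ≤ 2 - inner ℝ q x := by
        refine csSup_le hne ?_
        rintro _ ⟨p, hp, rfl⟩
        have := hx' p hp q hq
        simp only
        linarith
      linarith
    refine ⟨(sSup S, x), ⟨?_, ?_, mem_smul_of_forall_polarSet_le hK hKc hK0 h1, ?_⟩, rfl⟩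
    · simpa using h1 0 (hz K)
    · simpa using h2 0 (hz L)
    · simpa using mem_smul_of_forall_polarSet_le hL hLc hL0 h2
  · rintro ⟨⟨s, y⟩, ⟨h1, h2, ⟨a, ha, hax⟩, b, hb, hbx⟩, rfl⟩
    simp only [sub_zero] at h1 h2 hax hbx ⊢
    rintro _ ⟨_, ⟨p, hp, q, hq, rfl⟩, rfl⟩
    have hp' : inner ℝ p y ≤ s := by
      rw [← hax, inner_smul_right, real_inner_comm]
      nlinarith [hp a ha]
    have hq' : inner ℝ q y ≤ 2 - s := by
      rw [← hbx, inner_smul_right, real_inner_comm]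
      nlinarith [hq b hb]
    simp only [real_inner_smul_left, inner_add_left]
    linarith

end PolarSum

/-! ### The projected fibre over the origin. -/

section Midpoint

variable {E : Type*} [NormedAddCommGroup E] [NormedSpace ℝ E]

theorem inter_subset_snd_image_joinFiber (K L : Set E) :
    K ∩ L ⊆ Prod.snd '' joinFiber K L 2 0 := by
  rintro x ⟨hx, hx'⟩
  refine ⟨(1, x), ⟨zero_le_one, one_le_two, by simpa using hx, ?_⟩, rfl⟩
  norm_num
  exact hx'

theorem snd_image_joinFiber_smul (K L : Set E) {h : ℝ} (hh : 0 < h) :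
    Prod.snd '' joinFiber K L h 0 = h • (Prod.snd '' joinFiber K L 1 0) := by
  have := joinFiber_smul K L 1 0 hh
  rw [mul_one, smul_zero] at this
  rw [this]
  ext x
  simp only [Set.mem_image, Set.mem_smul_set]
  constructor
  · rintro ⟨_, ⟨p, hp, rfl⟩, rfl⟩
    exact ⟨_, ⟨p, hp, rfl⟩, rfl⟩
  · rintro ⟨_, ⟨p, hp, rfl⟩, rfl⟩
    exact ⟨_, ⟨p, hp, rfl⟩, rfl⟩

end Midpoint

/-! ### Integrals of powers of one minus the gauge, by layers. -/

section ConeIntegral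

variable {E : Type*} [NormedAddCommGroup E] [NormedSpace ℝ E]

/-- The integral of `(k + 1) (1 - r) ^ k` over the `r ∈ (0, 1)` with `z ∈ r • A`; it equals
`(1 - ‖z‖) ^ (k + 1)` on `A`, where `‖·‖` is the gauge of `A`. -/
noncomputable def coneDensity (k : ℕ) (A : Set E) (z : E) : ENNReal :=
  ∫⁻ r in {r : ℝ | r ∈ Set.Ioo 0 1 ∧ z ∈ r • A}, ENNReal.ofReal ((k + 1) * (1 - r) ^ k)

theorem lintegral_Icc_one_sub_pow (k : ℕ) {g : ℝ} (hg : g ≤ 1) :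
    ∫⁻ r in Set.Icc g 1, ENNReal.ofReal ((k + 1) * (1 - r) ^ k) =
      ENNReal.ofReal ((1 - g) ^ (k + 1)) := by
  rw [← ofReal_integral_eq_lintegral_ofReal]
  · rw [integral_Icc_eq_integral_Ioc, ← intervalIntegral.integral_of_le hg,
      intervalIntegral.integral_const_mul,
      intervalIntegral.integral_comp_sub_left (fun x : ℝ => x ^ k), integral_pow]
    congr 1
    have : (k : ℝ) + 1 ≠ 0 := by positivity
    field_simp
    simp
  · exact (Continuous.integrableOn_Icc (by fun_prop))
  · refine (ae_restrict_iff' measurableSet_Icc).2 (Filter.Eventually.of_forall fun r hr => ?_)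
    have : 0 ≤ 1 - r := sub_nonneg.2 hr.2
    simp only [Pi.zero_apply]
    positivity

theorem coneDensity_le_of_le (k : ℕ) (A : Set E) (z : E) {g : ℝ}
    (h : ∀ r ∈ Set.Ioo (0 : ℝ) 1, z ∈ r • A → g ≤ r) (hg : g ≤ 1) :
    coneDensity k A z ≤ ENNReal.ofReal ((1 - g) ^ (k + 1)) := by
  rw [← lintegral_Icc_one_sub_pow k hg]
  exact lintegral_mono_set fun r hr => ⟨h r hr.1 hr.2, hr.1.2.le⟩

/-- The admissible `r` have the gauge as infimum, and the hypothesis is a closed condition on `r`,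
so it persists at the infimum, where it bounds the whole integral. -/
theorem mul_coneDensity_le (k : ℕ) (A : Set E) (z : E) {b c : ENNReal} (hc : c ≠ ⊤)
    (h : ∀ r ∈ Set.Ioo (0 : ℝ) 1, z ∈ r • A → ENNReal.ofReal ((1 - r) ^ (k + 1)) * c ≤ b) :
    coneDensity k A z * c ≤ b := by
  set S := {r : ℝ | r ∈ Set.Ioo (0 : ℝ) 1 ∧ z ∈ r • A} with hS
  rcases S.eq_empty_or_nonempty with hem | hne
  · have : coneDensity k A z = 0 := by
      rw [coneDensity, ← hS, hem]
      simp
    simp [this]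
  have hb : BddBelow S := ⟨0, fun r hr => hr.1.1.le⟩
  have hg : ∀ r ∈ Set.Ioo (0 : ℝ) 1, z ∈ r • A → sInf S ≤ r := fun r h1 h2 => csInf_le hb ⟨h1, h2⟩
  have hg1 : sInf S ≤ 1 := by
    obtain ⟨r, hr⟩ := hne
    exact (hg r hr.1 hr.2).trans hr.1.2.le
  refine (mul_le_mul_left (coneDensity_le_of_le k A z hg hg1) c).trans ?_
  have hcl : IsClosed {r : ℝ | ENNReal.ofReal ((1 - r) ^ (k + 1)) * c ≤ b} := by
    refine isClosed_le ?_ continuous_const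
    exact (ENNReal.continuous_mul_const hc).comp (ENNReal.continuous_ofReal.comp (by fun_prop))
  exact hcl.closure_subset_iff.2 (fun r hr => h r hr.1 hr.2) (csInf_mem_closure hne hb)

variable [FiniteDimensional ℝ E] [MeasurableSpace E] [BorelSpace E] (μ : Measure E)
  [μ.IsAddHaarMeasure]

theorem measurableSet_cone {A : Set E} (hA : MeasurableSet A) :
    MeasurableSet {p : E × ℝ | p.2 ∈ Set.Ioo (0 : ℝ) 1 ∧ p.1 ∈ p.2 • A} := by
  have : {p : E × ℝ | p.2 ∈ Set.Ioo (0 : ℝ) 1 ∧ p.1 ∈ p.2 • A} =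
      {p : E × ℝ | p.2 ∈ Set.Ioo (0 : ℝ) 1} ∩ (fun p : E × ℝ => p.2⁻¹ • p.1) ⁻¹' A := by
    ext ⟨z, r⟩
    simp only [Set.mem_ofPred_eq, Set.mem_inter_iff, Set.mem_preimage]
    refine and_congr_right fun hr => ?_
    rw [Set.mem_smul_set_iff_inv_smul_mem₀ hr.1.ne']
  rw [this]
  refine (measurableSet_Ioo.preimage measurable_snd).inter (hA.preimage ?_)
  exact (measurable_snd.inv).smul measurable_fst

theorem coneDensity_eq_lintegral_indicator (k : ℕ) {A : Set E} (hA : MeasurableSet A) (z : E) :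
    coneDensity k A z = ∫⁻ r, {p : E × ℝ | p.2 ∈ Set.Ioo (0 : ℝ) 1 ∧ p.1 ∈ p.2 • A}.indicator
      (fun p => ENNReal.ofReal ((k + 1) * (1 - p.2) ^ k)) (z, r) := by
  rw [coneDensity, ← lintegral_indicator]
  · rfl
  · exact (measurableSet_cone hA).preimage measurable_prodMk_left

theorem measurable_cone_indicator (k : ℕ) {A : Set E} (hA : MeasurableSet A) :
    Measurable ({p : E × ℝ | p.2 ∈ Set.Ioo (0 : ℝ) 1 ∧ p.1 ∈ p.2 • A}.indicator
      (fun p => ENNReal.ofReal ((k + 1) * (1 - p.2) ^ k))) :=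
  Measurable.indicator (by fun_prop) (measurableSet_cone hA)

theorem measurable_coneDensity (k : ℕ) {A : Set E} (hA : MeasurableSet A) :
    Measurable (coneDensity k A) := by
  simp_rw [funext (coneDensity_eq_lintegral_indicator k hA)]
  exact (measurable_cone_indicator k hA).lintegral_prod_right'

theorem lintegral_coneDensity (k : ℕ) {A : Set E} (hA : MeasurableSet A) :
    ∫⁻ z, coneDensity k A z ∂μ =
      (∫⁻ r in Set.Ioo (0 : ℝ) 1,
        ENNReal.ofReal ((k + 1) * (1 - r) ^ k * r ^ Module.finrank ℝ E)) * μ A := by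
  simp_rw [coneDensity_eq_lintegral_indicator k hA]
  rw [lintegral_lintegral_swap (f := fun z r =>
      {p : E × ℝ | p.2 ∈ Set.Ioo (0 : ℝ) 1 ∧ p.1 ∈ p.2 • A}.indicator
        (fun p => ENNReal.ofReal ((k + 1) * (1 - p.2) ^ k)) (z, r))
      (measurable_cone_indicator k hA).aemeasurable,
    ← lintegral_mul_const _ (by fun_prop), ← lintegral_indicator measurableSet_Ioo]
  refine lintegral_congr fun r => ?_
  by_cases hr : r ∈ Set.Ioo (0 : ℝ) 1
  · rw [Set.indicator_of_mem hr]
    have h1 (z : E) : {p : E × ℝ | p.2 ∈ Set.Ioo (0 : ℝ) 1 ∧ p.1 ∈ p.2 • A}.indicator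
        (fun p => ENNReal.ofReal ((k + 1) * (1 - p.2) ^ k)) (z, r) =
        (r • A).indicator (fun _ => ENNReal.ofReal ((k + 1) * (1 - r) ^ k)) z := by
      by_cases hz : z ∈ r • A
      · rw [Set.indicator_of_mem hz]
        exact Set.indicator_of_mem (s := {p : E × ℝ | p.2 ∈ Set.Ioo (0 : ℝ) 1 ∧ p.1 ∈ p.2 • A})
          ⟨hr, hz⟩ _
      · rw [Set.indicator_of_notMem hz, Set.indicator_of_notMem fun h => hz h.2]
    simp_rw [h1]
    rw [lintegral_indicator_const (hA.const_smul₀ r), Measure.addHaar_smul,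
      abs_of_nonneg (pow_nonneg hr.1.le _), ← mul_assoc, ← ENNReal.ofReal_mul]
    have : 0 ≤ 1 - r := sub_nonneg.2 hr.2.le
    positivity
  · rw [Set.indicator_of_notMem hr]
    have h1 (z : E) : {p : E × ℝ | p.2 ∈ Set.Ioo (0 : ℝ) 1 ∧ p.1 ∈ p.2 • A}.indicator
        (fun p => ENNReal.ofReal ((k + 1) * (1 - p.2) ^ k)) (z, r) = 0 :=
      Set.indicator_of_notMem (fun h => hr h.1) _
    exact (lintegral_congr h1).trans lintegral_zero

end ConeIntegral

/-! ### Volume estimates for the fibres. -/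

section FiberVolume

variable {E : Type*} [NormedAddCommGroup E] [NormedSpace ℝ E] [FiniteDimensional ℝ E]
  [MeasurableSpace E] [BorelSpace E] (μ : Measure E) [μ.IsAddHaarMeasure] {K L : Set E}

theorem measurable_measure_joinFiber (hK : IsCompact K) (hL : IsCompact L) :
    Measurable fun z => ((volume : Measure ℝ).prod μ) (joinFiber K L 1 z) :=
  measurable_measure_prodMk_left (isCompact_joinTotal hK hL).measurableSet

/-- Tonelli with `(s, x)` fixed: `x` runs over `s • K` and `z` over `x - (1 - s) • L`. -/
theorem lintegral_measure_joinFiber_le (hK : IsCompact K) (hL : IsCompact L) :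
    ∫⁻ z, ((volume : Measure ℝ).prod μ) (joinFiber K L 1 z) ∂μ ≤
      (∫⁻ r in Set.Ioo (0 : ℝ) 1,
        ENNReal.ofReal ((1 - r) ^ Module.finrank ℝ E * r ^ Module.finrank ℝ E)) *
        (μ K * μ L) := by
  have hm := (isCompact_joinTotal hK hL).measurableSet
  have h1 := Measure.prod_apply (μ := μ) (ν := (volume : Measure ℝ).prod μ) hm
  have h2 := Measure.prod_apply_symm (μ := μ) (ν := (volume : Measure ℝ).prod μ) hm
  refine (h1.symm.trans h2).le.trans ?_
  rw [lintegral_prod _ (measurable_measure_prodMk_right hm).aemeasurable,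
    ← lintegral_mul_const _ (by fun_prop), restrict_Ioo_eq_restrict_Icc,
    ← lintegral_indicator measurableSet_Icc]
  refine lintegral_mono fun s => ?_
  by_cases hs : s ∈ Set.Icc (0 : ℝ) 1
  · rw [Set.indicator_of_mem hs]
    have h3 (x : E) : μ ((fun z : E => (z, (s, x))) ⁻¹'
        {q : E × (ℝ × E) | q.2 ∈ joinFiber K L 1 q.1}) ≤
        (s • K).indicator (fun _ => μ ((1 - s) • L)) x := by
      by_cases hx : x ∈ s • K
      · rw [Set.indicator_of_mem hx,
          ← (μ.measurePreserving_sub_left x).measure_preimage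
            (hL.smul (1 - s)).measurableSet.nullMeasurableSet]
        exact measure_mono fun z hz => hz.2.2.2
      · rw [Set.indicator_of_notMem hx]
        refine le_of_eq (measure_mono_null (t := ∅) (fun z hz => hx hz.2.2.1) measure_empty)
    refine (lintegral_mono h3).trans ?_
    rw [lintegral_indicator_const (hK.smul s).measurableSet, Measure.addHaar_smul,
      Measure.addHaar_smul, abs_of_nonneg (pow_nonneg hs.1 _),
      abs_of_nonneg (pow_nonneg (sub_nonneg.2 hs.2) _),
      ENNReal.ofReal_mul (pow_nonneg (sub_nonneg.2 hs.2) _)]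
    exact le_of_eq (by ring)
  · rw [Set.indicator_of_notMem hs]
    have h3 (x : E) : μ ((fun z : E => (z, (s, x))) ⁻¹'
        {q : E × (ℝ × E) | q.2 ∈ joinFiber K L 1 q.1}) = 0 :=
      measure_mono_null (t := ∅) (fun z hz => hs ⟨hz.1, hz.2.1⟩) measure_empty
    exact ((lintegral_congr h3).trans lintegral_zero).le

theorem measure_joinFiber_smul (K L : Set E) {h : ℝ} (hh : 0 < h) (z : E) :
    ((volume : Measure ℝ).prod μ) (joinFiber K L h (h • z)) =
      ENNReal.ofReal (h ^ (Module.finrank ℝ E + 1)) *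
        ((volume : Measure ℝ).prod μ) (joinFiber K L 1 z) := by
  have h1 := joinFiber_smul K L 1 z hh
  rw [mul_one] at h1
  rw [h1, Measure.addHaar_smul, Module.finrank_prod, Module.finrank_self, add_comm 1,
    abs_of_nonneg (by positivity)]

/-- Translation by `p` carries the fibre of height `1 - r` over `(1 - r) • w` into the fibre of
height `1` on the right. -/
theorem ofReal_mul_measure_joinFiber_le_of_mem (hK : Convex ℝ K) (hL : Convex ℝ L) {r : ℝ}
    (hr1 : r < 1) {z w : E} {p : ℝ × E} (hp : p ∈ joinFiber K L r z) :
    ENNReal.ofReal ((1 - r) ^ (Module.finrank ℝ E + 1)) *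
        ((volume : Measure ℝ).prod μ) (joinFiber K L 1 w) ≤
      ((volume : Measure ℝ).prod μ) (joinFiber K L 1 (z + (1 - r) • w)) := by
  rw [← measure_joinFiber_smul μ K L (sub_pos.2 hr1),
    ← measure_preimage_add ((volume : Measure ℝ).prod μ) (-p)]
  refine measure_mono fun q hq => ?_
  have := joinFiber_add hK hL hp hq
  simpa using this

theorem ofReal_mul_measure_joinFiber_le (hK : Convex ℝ K) (hL : Convex ℝ L) (hK0 : (0 : E) ∈ K)
    (hL0 : (0 : E) ∈ L) {r : ℝ} (hr0 : 0 ≤ r) (hr1 : r < 1) {z : E}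
    (hz : z ∈ r • convexHull ℝ (K ∪ -L)) :
    ENNReal.ofReal ((1 - r) ^ (Module.finrank ℝ E + 1)) *
        ((volume : Measure ℝ).prod μ) (joinFiber K L 1 0) ≤
      ((volume : Measure ℝ).prod μ) (joinFiber K L 1 z) := by
  obtain ⟨p, hp⟩ := (mem_smul_convexHull_union_neg hK hL hK0 hL0 hr0).1 hz
  simpa using ofReal_mul_measure_joinFiber_le_of_mem μ hK hL hr1 (w := 0) hp

/-- Over a point of gauge `r` in the projection, the fibre contains a segment of length `1 - r`; the
integral of `1 - r` over the projection is its volume divided by `n + 1`. -/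
theorem measure_snd_image_joinFiber_le (hK : IsCompact K) (hL : IsCompact L)
    (hKc : Convex ℝ K) (hLc : Convex ℝ L) (hK0 : (0 : E) ∈ K) (hL0 : (0 : E) ∈ L) :
    μ (Prod.snd '' joinFiber K L 1 0) ≤ (Module.finrank ℝ E + 1) *
      ((volume : Measure ℝ).prod μ) (joinFiber K L 1 0) := by
  have hcomp := isCompact_joinFiber_one hK hL 0
  have hM := (hcomp.image continuous_snd).measurableSet
  have h1 := lintegral_coneDensity μ 0 hM
  have hγ : ∫⁻ r in Set.Ioo (0 : ℝ) 1, ENNReal.ofReal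
      (((0 : ℕ) + 1) * (1 - r) ^ 0 * r ^ Module.finrank ℝ E) =
      ENNReal.ofReal (1 / (Module.finrank ℝ E + 1)) := by
    simp only [CharP.cast_eq_zero, zero_add, pow_zero, mul_one, one_mul]
    rw [restrict_Ioo_eq_restrict_Ioc, ← ofReal_integral_eq_lintegral_ofReal,
      ← intervalIntegral.integral_of_le zero_le_one, integral_pow]
    · simp
    · exact (Continuous.integrableOn_Icc (by fun_prop)).mono_set Set.Ioc_subset_Icc_self
    · refine (ae_restrict_iff' measurableSet_Ioc).2 (Filter.Eventually.of_forall fun r hr => ?_)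
      exact pow_nonneg hr.1.le _
  have h2 : ∫⁻ z, coneDensity 0 (Prod.snd '' joinFiber K L 1 0) z ∂μ ≤
      ((volume : Measure ℝ).prod μ) (joinFiber K L 1 0) := by
    rw [Measure.prod_apply_symm hcomp.measurableSet]
    refine lintegral_mono fun y => ?_
    rw [← mul_one (coneDensity _ _ y)]
    refine mul_coneDensity_le 0 _ y ENNReal.one_ne_top fun r hr hy => ?_
    obtain ⟨_, ⟨⟨s, x⟩, hsx, rfl⟩, rfl⟩ := hy
    obtain ⟨g1, g2, g3, g4⟩ := smul_mem_joinFiber hr.1.le hsx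
    simp only [Prod.smul_mk, smul_eq_mul, mul_one, smul_zero, sub_zero] at g1 g2 g3 g4
    have h3 : ENNReal.ofReal ((1 - r) ^ (0 + 1)) * 1 =
        volume (Set.Icc (r * s) (r * s + (1 - r))) := by
      rw [Real.volume_Icc]
      simp
    rw [h3]
    -- Since `y ∈ (r * s) • K` and `y ∈ (r - r * s) • L`, the slack `1 - r` may be shared between
    -- the two factors in any way.
    refine measure_mono fun t ht => ?_
    refine ⟨g1.trans ht.1, by linarith [ht.2], mem_smul_of_le hKc hK0 g1 ht.1 g3, ?_⟩
    simp only [sub_zero]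
    exact mem_smul_of_le hLc hL0 (sub_nonneg.2 g2) (by linarith [ht.2]) g4
  rw [h1, hγ] at h2
  have h3 : ((Module.finrank ℝ E : ENNReal) + 1) *
      ENNReal.ofReal (1 / (Module.finrank ℝ E + 1)) = 1 := by
    have : ((Module.finrank ℝ E : ENNReal) + 1) = ENNReal.ofReal (Module.finrank ℝ E + 1) := by
      rw [ENNReal.ofReal_add (by positivity) zero_le_one]
      simp
    rw [this, ← ENNReal.ofReal_mul (by positivity), mul_one_div_cancel (by positivity)]
    simp
  calc μ (Prod.snd '' joinFiber K L 1 0) = (Module.finrank ℝ E + 1) *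
        (ENNReal.ofReal (1 / (Module.finrank ℝ E + 1)) * μ (Prod.snd '' joinFiber K L 1 0)) := by
        rw [← mul_assoc, h3, one_mul]
    _ ≤ _ := mul_le_mul_right h2 _

end FiberVolume

/-! ### The strengthened Rogers–Shephard inequality, and equality almost everywhere. -/

section RogersShephard

variable {E : Type*} [NormedAddCommGroup E] [NormedSpace ℝ E] [FiniteDimensional ℝ E]
  [MeasurableSpace E] [BorelSpace E] (μ : Measure E) [μ.IsAddHaarMeasure] {K L : Set E}

theorem lintegral_beta_ne_zero (d : ℕ) :
    ∫⁻ r in Set.Ioo (0 : ℝ) 1, ENNReal.ofReal ((1 - r) ^ d * r ^ d) ≠ 0 := by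
  rw [← pos_iff_ne_zero, setLIntegral_pos_iff (by fun_prop)]
  have : Set.Ioo (0 : ℝ) 1 ⊆
      (Function.support fun r : ℝ => ENNReal.ofReal ((1 - r) ^ d * r ^ d)) ∩ Set.Ioo 0 1 := by
    intro r hr
    refine ⟨?_, hr⟩
    have h1 : 0 < 1 - r := sub_pos.2 hr.2
    have h2 : 0 < r := hr.1
    rw [Function.mem_support, ← pos_iff_ne_zero, ENNReal.ofReal_pos]
    positivity
  refine lt_of_lt_of_le ?_ (measure_mono this)
  simp

theorem lintegral_beta_ne_top (d : ℕ) :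
    ∫⁻ r in Set.Ioo (0 : ℝ) 1, ENNReal.ofReal ((1 - r) ^ d * r ^ d) ≠ ⊤ := by
  have h : ∫⁻ r in Set.Ioo (0 : ℝ) 1, ENNReal.ofReal ((1 - r) ^ d * r ^ d) ≤
      ∫⁻ _ in Set.Ioo (0 : ℝ) 1, 1 := by
    refine setLIntegral_mono measurable_const fun r hr => ?_
    rw [ENNReal.ofReal_le_one]
    exact mul_le_one₀ (pow_le_one₀ (sub_nonneg.2 hr.2.le) (by linarith [hr.1]))
      (pow_nonneg hr.1.le _) (pow_le_one₀ hr.1.le hr.2.le)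
  refine ne_top_of_le_ne_top ?_ h
  simp

/-- The factor `n + 1` in the cone density cancels the one lost in `measure_snd_image_joinFiber_le`,
leaving the same beta integral as in the upper bound. -/
theorem mul_measure_mul_measure_le_lintegral (hK : IsCompact K) (hL : IsCompact L)
    (hKc : Convex ℝ K) (hLc : Convex ℝ L) (hK0 : (0 : E) ∈ K) (hL0 : (0 : E) ∈ L) :
    (∫⁻ r in Set.Ioo (0 : ℝ) 1,
        ENNReal.ofReal ((1 - r) ^ Module.finrank ℝ E * r ^ Module.finrank ℝ E)) *
        (μ (Prod.snd '' joinFiber K L 1 0) * μ (convexHull ℝ (K ∪ -L))) ≤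
      ∫⁻ z, coneDensity (Module.finrank ℝ E) (convexHull ℝ (K ∪ -L)) z *
        ((volume : Measure ℝ).prod μ) (joinFiber K L 1 0) ∂μ := by
  have hA := (isCompact_convexHull_union_neg hK hL hKc hLc hK0 hL0).measurableSet
  rw [lintegral_mul_const _ (measurable_coneDensity _ hA), lintegral_coneDensity μ _ hA]
  have h1 (r : ℝ) : ENNReal.ofReal (((Module.finrank ℝ E : ℕ) + 1) *
      (1 - r) ^ Module.finrank ℝ E * r ^ Module.finrank ℝ E) = (Module.finrank ℝ E + 1) *
      ENNReal.ofReal ((1 - r) ^ Module.finrank ℝ E * r ^ Module.finrank ℝ E) := by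
    rw [mul_assoc, ENNReal.ofReal_mul (by positivity), ENNReal.ofReal_add (by positivity)
      zero_le_one]
    simp
  simp_rw [h1]
  rw [lintegral_const_mul _ (by fun_prop)]
  refine (mul_le_mul_right (mul_le_mul_left
    (measure_snd_image_joinFiber_le μ hK hL hKc hLc hK0 hL0) _) _).trans (le_of_eq ?_)
  ring

theorem coneDensity_mul_measure_le (hK : IsCompact K) (hL : IsCompact L)
    (hKc : Convex ℝ K) (hLc : Convex ℝ L) (hK0 : (0 : E) ∈ K) (hL0 : (0 : E) ∈ L) (z : E) :
    coneDensity (Module.finrank ℝ E) (convexHull ℝ (K ∪ -L)) z *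
        ((volume : Measure ℝ).prod μ) (joinFiber K L 1 0) ≤
      ((volume : Measure ℝ).prod μ) (joinFiber K L 1 z) :=
  mul_coneDensity_le _ _ _ (isCompact_joinFiber_one hK hL 0).measure_lt_top.ne fun _ hr hz =>
    ofReal_mul_measure_joinFiber_le μ hKc hLc hK0 hL0 hr.1.le hr.2 hz

theorem measure_snd_image_joinFiber_two (K L : Set E) :
    μ (Prod.snd '' joinFiber K L 2 0) =
      2 ^ Module.finrank ℝ E * μ (Prod.snd '' joinFiber K L 1 0) := by
  rw [snd_image_joinFiber_smul K L two_pos, Measure.addHaar_smul, abs_of_nonneg (by positivity),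
    ENNReal.ofReal_pow (by positivity)]
  simp

theorem measure_mul_measure_convexHull_le (hK : IsCompact K) (hL : IsCompact L)
    (hKc : Convex ℝ K) (hLc : Convex ℝ L) (hK0 : (0 : E) ∈ K) (hL0 : (0 : E) ∈ L) :
    μ (Prod.snd '' joinFiber K L 2 0) * μ (convexHull ℝ (K ∪ -L)) ≤
      2 ^ Module.finrank ℝ E * μ K * μ L := by
  have h1 := (mul_measure_mul_measure_le_lintegral μ hK hL hKc hLc hK0 hL0).trans
    ((lintegral_mono (coneDensity_mul_measure_le μ hK hL hKc hLc hK0 hL0)).trans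
      (lintegral_measure_joinFiber_le μ hK hL))
  rw [ENNReal.mul_le_mul_iff_right (lintegral_beta_ne_zero _) (lintegral_beta_ne_top _)] at h1
  rw [measure_snd_image_joinFiber_two, mul_assoc, mul_assoc]
  exact mul_le_mul_right h1 _

theorem measure_joinFiber_ae_eq (hK : IsCompact K) (hL : IsCompact L)
    (hKc : Convex ℝ K) (hLc : Convex ℝ L) (hK0 : (0 : E) ∈ K) (hL0 : (0 : E) ∈ L)
    (heq : μ (Prod.snd '' joinFiber K L 2 0) * μ (convexHull ℝ (K ∪ -L)) =
      2 ^ Module.finrank ℝ E * μ K * μ L) :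
    ∀ᵐ z ∂μ, coneDensity (Module.finrank ℝ E) (convexHull ℝ (K ∪ -L)) z *
        ((volume : Measure ℝ).prod μ) (joinFiber K L 1 0) =
      ((volume : Measure ℝ).prod μ) (joinFiber K L 1 z) := by
  have h1 := lintegral_measure_joinFiber_le μ hK hL
  rw [measure_snd_image_joinFiber_two, mul_assoc, mul_assoc,
    ENNReal.mul_right_inj (by positivity) (by finiteness)] at heq
  refine ae_eq_of_ae_le_of_lintegral_le
    (Filter.Eventually.of_forall (coneDensity_mul_measure_le μ hK hL hKc hLc hK0 hL0)) ?_
    (measurable_measure_joinFiber μ hK hL).aemeasurable ?_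
  · refine ne_top_of_le_ne_top ?_
      ((lintegral_mono (coneDensity_mul_measure_le μ hK hL hKc hLc hK0 hL0)).trans h1)
    exact ENNReal.mul_ne_top (lintegral_beta_ne_top _)
      (ENNReal.mul_ne_top hK.measure_lt_top.ne hL.measure_lt_top.ne)
  · rw [← heq] at h1
    exact h1.trans (mul_measure_mul_measure_le_lintegral μ hK hL hKc hLc hK0 hL0)

theorem nonempty_interior_of_measure_ne_zero {Y : Set E} (hY : Convex ℝ Y) (h0 : μ Y ≠ 0) :
    (interior Y).Nonempty := by
  by_contra h
  rw [Set.not_nonempty_iff_eq_empty] at h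
  have h2 := hY.addHaar_frontier μ
  rw [frontier, h, Set.sdiff_empty] at h2
  exact h0 (measure_mono_null subset_closure h2)

/-- A point of `Y` outside the closed set `X` is a limit of interior points of `Y`, so `Y \ X` would
contain a nonempty open set. -/
theorem subset_of_measure_le {X Y : Set E} (hX : IsClosed X) (hY : Convex ℝ Y) (hXY : X ⊆ Y)
    (hX0 : μ X ≠ 0) (hXt : μ X ≠ ⊤) (hle : μ Y ≤ μ X) : Y ⊆ X := by
  by_contra hcon
  obtain ⟨y, hy, hyX⟩ := Set.not_subset.1 hcon
  have hint : (interior Y).Nonempty := nonempty_interior_of_measure_ne_zero μ hY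
    fun h => hX0 (measure_mono_null hXY h)
  have hmem : y ∈ closure (interior Y) :=
    hY.closure_interior_eq_closure_of_nonempty_interior hint ▸ subset_closure hy
  obtain ⟨w, hw1, hw2⟩ := mem_closure_iff.1 hmem Xᶜ hX.isOpen_compl hyX
  have hpos : 0 < μ (Xᶜ ∩ interior Y) :=
    (hX.isOpen_compl.inter isOpen_interior).measure_pos μ ⟨w, hw1, hw2⟩
  have hsub : Xᶜ ∩ interior Y ⊆ Y \ X := fun v hv => ⟨interior_subset hv.2, hv.1⟩
  have h0 : μ (Y \ X) = 0 := by
    rw [measure_sdiff hXY hX.measurableSet.nullMeasurableSet hXt]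
    exact tsub_eq_zero_of_le hle
  exact hpos.ne' (measure_mono_null hsub h0)

end RogersShephard

/-! ### From equality of volumes to equality of fibres. -/

section Rigidity

variable {E : Type*} [NormedAddCommGroup E] [NormedSpace ℝ E] [FiniteDimensional ℝ E]
  [MeasurableSpace E] [BorelSpace E] (μ : Measure E) [μ.IsAddHaarMeasure] {K L : Set E}

/-- This is lower semicontinuity of the fibre volume at `w`: a nearby `z` is `ε • y + (1 - ε) • w`
with `y` in the hull. -/
theorem eventually_ofReal_mul_measure_joinFiber_le (hK : Convex ℝ K) (hL : Convex ℝ L)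
    (hK0 : (0 : E) ∈ K) (hL0 : (0 : E) ∈ L) {w : E} (hw : convexHull ℝ (K ∪ -L) ∈ nhds w) {ε : ℝ}
    (hε0 : 0 < ε) (hε1 : ε < 1) :
    ∀ᶠ z in nhds w, ENNReal.ofReal ((1 - ε) ^ (Module.finrank ℝ E + 1)) *
        ((volume : Measure ℝ).prod μ) (joinFiber K L 1 w) ≤
      ((volume : Measure ℝ).prod μ) (joinFiber K L 1 z) := by
  have hc : Filter.Tendsto (fun z : E => w + ε⁻¹ • (z - w)) (nhds w) (nhds w) := by
    have : Continuous fun z : E => w + ε⁻¹ • (z - w) := by fun_prop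
    simpa using this.tendsto w
  filter_upwards [hc hw] with z hz
  obtain ⟨p, hp⟩ := (mem_smul_convexHull_union_neg hK hL hK0 hL0 hε0.le).1
    (Set.smul_mem_smul_set (a := ε) hz)
  have := ofReal_mul_measure_joinFiber_le_of_mem μ hK hL hε1 (w := w) hp
  convert this using 3
  rw [smul_add, smul_inv_smul₀ hε0.ne', sub_smul, one_smul]
  abel

/-- A strict failure at `w` would persist nearby, by lower semicontinuity of the fibre volume and
continuity of the gauge, and so meet the dense set where equality holds. -/
theorem measure_joinFiber_le_gauge (hK : IsCompact K) (hL : IsCompact L)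
    (hKc : Convex ℝ K) (hLc : Convex ℝ L) (hK0 : (0 : E) ∈ K) (hL0 : (0 : E) ∈ L)
    (hA : convexHull ℝ (K ∪ -L) ∈ nhds 0)
    (heq : μ (Prod.snd '' joinFiber K L 2 0) * μ (convexHull ℝ (K ∪ -L)) =
      2 ^ Module.finrank ℝ E * μ K * μ L) {w : E} (hw : gauge (convexHull ℝ (K ∪ -L)) w < 1) :
    ((volume : Measure ℝ).prod μ) (joinFiber K L 1 w) ≤
      ENNReal.ofReal ((1 - gauge (convexHull ℝ (K ∪ -L)) w) ^ (Module.finrank ℝ E + 1)) *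
        ((volume : Measure ℝ).prod μ) (joinFiber K L 1 0) := by
  set A := convexHull ℝ (K ∪ -L) with hAdef
  set ν := (volume : Measure ℝ).prod μ
  by_contra! hcon
  have hAc : Convex ℝ A := convex_convexHull ℝ _
  have hg : Continuous (gauge A) := continuous_gauge hAc hA
  have hfin (z : E) : ν (joinFiber K L 1 z) ≠ ⊤ :=
    (isCompact_joinFiber_one hK hL z).measure_lt_top.ne
  have hnhds : A ∈ nhds w := by
    have : {z | gauge A z < 1} ∈ nhds w := (isOpen_lt hg continuous_const).mem_nhds hw
    refine Filter.mem_of_superset this ?_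
    exact setOfPred_gauge_lt_one_subset_self hAc (mem_of_mem_nhds hA) (absorbent_nhds_zero hA)
  have h1 : Filter.Tendsto (fun ε : ℝ => ENNReal.ofReal ((1 - ε) ^ (Module.finrank ℝ E + 1)) *
      ν (joinFiber K L 1 w)) (nhdsWithin 0 (Set.Ioo 0 1)) (nhds (ν (joinFiber K L 1 w))) := by
    have : Continuous fun ε : ℝ => ENNReal.ofReal ((1 - ε) ^ (Module.finrank ℝ E + 1)) *
        ν (joinFiber K L 1 w) :=
      (ENNReal.continuous_mul_const (hfin w)).comp (ENNReal.continuous_ofReal.comp (by fun_prop))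
    have h := this.tendsto 0
    simp only [sub_zero, one_pow, ENNReal.ofReal_one, one_mul] at h
    exact h.mono_left nhdsWithin_le_nhds
  have hne : (nhdsWithin (0 : ℝ) (Set.Ioo 0 1)).NeBot := by
    rw [nhdsWithin_Ioo_eq_nhdsGT zero_lt_one]
    infer_instance
  obtain ⟨ε, hε, hε0, hε1⟩ := ((h1.eventually (lt_mem_nhds hcon)).and
    (eventually_mem_nhdsWithin (a := (0 : ℝ)) (s := Set.Ioo 0 1))).exists
  have h2 := eventually_ofReal_mul_measure_joinFiber_le μ hKc hLc hK0 hL0 hnhds hε0 hε1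
  have h3 : ∀ᶠ z in nhds w, ENNReal.ofReal ((1 - gauge A z) ^ (Module.finrank ℝ E + 1)) *
      ν (joinFiber K L 1 0) <
      ENNReal.ofReal ((1 - ε) ^ (Module.finrank ℝ E + 1)) * ν (joinFiber K L 1 w) := by
    have : Continuous fun z => ENNReal.ofReal ((1 - gauge A z) ^ (Module.finrank ℝ E + 1)) *
        ν (joinFiber K L 1 0) :=
      (ENNReal.continuous_mul_const (hfin 0)).comp (ENNReal.continuous_ofReal.comp (by fun_prop))
    exact (this.tendsto w).eventually (gt_mem_nhds hε)
  have h4 : ∀ᶠ z in nhds w, gauge A z < 1 := (hg.tendsto w).eventually (gt_mem_nhds hw)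
  have h5 : ∃ᶠ z in nhds w, coneDensity (Module.finrank ℝ E) A z * ν (joinFiber K L 1 0) =
      ν (joinFiber K L 1 z) := by
    have hd := Measure.dense_of_ae (measure_joinFiber_ae_eq μ hK hL hKc hLc hK0 hL0 heq)
    exact mem_closure_iff_frequently.1 (hd w)
  obtain ⟨z, h5, h2, h3, h4⟩ := (h5.and_eventually (h2.and (h3.and h4))).exists
  refine absurd ((h3.trans_le h2).trans_le h5.symm.le) (not_lt.2 ?_)
  refine mul_le_mul_left (coneDensity_le_of_le _ _ _ (fun r hr hz => ?_) h4.le) _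
  exact gauge_le_of_mem hr.1.le hz

/-- The translate by `p` of the fibre over `0` of height `h - r` lies in the fibre over `z` of
height `h`. Both have volume `(h - r)ⁿ⁺¹ F(0)`, so they coincide. -/
theorem sub_mem_joinFiber_of_measure_eq (hK : IsCompact K) (hL : IsCompact L)
    (hKc : Convex ℝ K) (hLc : Convex ℝ L) (hK0 : (0 : E) ∈ K) (hL0 : (0 : E) ∈ L)
    (hA : convexHull ℝ (K ∪ -L) ∈ nhds 0)
    (heq : μ (Prod.snd '' joinFiber K L 2 0) * μ (convexHull ℝ (K ∪ -L)) =
      2 ^ Module.finrank ℝ E * μ K * μ L) (hKi : (interior K).Nonempty)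
    (hLi : (interior L).Nonempty) {z : E} {r h : ℝ}
    (hmin : ∀ r' : ℝ, 0 ≤ r' → z ∈ r' • convexHull ℝ (K ∪ -L) → r ≤ r') (hr : 0 ≤ r) (hrh : r < h)
    {p q : ℝ × E} (hp : p ∈ joinFiber K L r z) (hq : q ∈ joinFiber K L h z) :
    q - p ∈ joinFiber K L (h - r) 0 := by
  set A := convexHull ℝ (K ∪ -L) with hAdef
  set ν := (volume : Measure ℝ).prod μ
  set d := Module.finrank ℝ E
  have hh : 0 < h := hr.trans_lt hrh
  have hzA : z ∈ r • A := (mem_smul_convexHull_union_neg hKc hLc hK0 hL0 hr).2 ⟨p, hp⟩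
  have hgz : gauge A z = r := by
    refine le_antisymm (gauge_le_of_mem hr hzA) (le_of_forall_gt fun b hb => ?_)
    obtain ⟨a, ha0, hab, hza⟩ := exists_lt_of_gauge_lt (absorbent_nhds_zero hA) hb
    exact (hmin a ha0.le hza).trans_lt hab
  have hgw : gauge A (h⁻¹ • z) = r / h := by
    rw [gauge_smul_of_nonneg (inv_nonneg.2 hh.le), hgz, smul_eq_mul]
    ring
  have hle := measure_joinFiber_le_gauge μ hK hL hKc hLc hK0 hL0 hA heq (w := h⁻¹ • z)
    (by rw [hgw, div_lt_one hh]; exact hrh)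
  rw [hgw] at hle
  have hY := measure_joinFiber_smul μ K L hh (h⁻¹ • z)
  rw [smul_inv_smul₀ hh.ne'] at hY
  have hX := measure_joinFiber_smul μ K L (sub_pos.2 hrh) 0
  rw [smul_zero] at hX
  have hXp : ν ((fun q => -p + q) ⁻¹' joinFiber K L (h - r) 0) = ν (joinFiber K L (h - r) 0) :=
    measure_preimage_add ν (-p) _
  have hXc := isCompact_joinFiber hK hL (sub_pos.2 hrh) 0
  have hsub := subset_of_measure_le ν (hXc.isClosed.preimage (f := fun q => -p + q) (by fun_prop))
    (convex_joinFiber hKc hLc h z) (fun q hq => ?_) ?_ ?_ ?_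
  · have := hsub hq
    rwa [Set.mem_preimage, neg_add_eq_sub] at this
  · simpa using joinFiber_add hKc hLc hp hq
  · have hpos : ν (joinFiber K L 1 0) ≠ 0 := by
      intro h0
      have h1 := measure_snd_image_joinFiber_le μ hK hL hKc hLc hK0 hL0
      rw [measure_snd_image_joinFiber_two] at heq
      have h2 : μ (Prod.snd '' joinFiber K L 1 0) = 0 := by
        refine le_antisymm (h1.trans ?_) zero_le
        change _ * ν (joinFiber K L 1 0) ≤ 0
        rw [h0, mul_zero]
      rw [h2, mul_zero, zero_mul] at heq
      have h3 : μ K ≠ 0 := (Measure.measure_pos_of_nonempty_interior μ hKi).ne'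
      have h4 : μ L ≠ 0 := (Measure.measure_pos_of_nonempty_interior μ hLi).ne'
      exact mul_ne_zero (mul_ne_zero (by positivity) h3) h4 heq.symm
    rw [hXp, hX]
    have := sub_pos.2 hrh
    refine mul_ne_zero ?_ hpos
    rw [← pos_iff_ne_zero, ENNReal.ofReal_pos]
    positivity
  · rw [hXp]
    exact hXc.measure_lt_top.ne
  · rw [hXp, hX, hY]
    refine (mul_le_mul_right hle _).trans (le_of_eq ?_)
    rw [← mul_assoc, ← ENNReal.ofReal_mul (by positivity), ← mul_pow]
    congr 3
    field_simp

end Rigidity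

/-! ### Rigidity forces `K ⊆ L`. -/

section FiberRigid

variable {E : Type*} [NormedAddCommGroup E] [NormedSpace ℝ E] {K L : Set E}

/-- For every `z` with least dilation factor `r` into `conv (K ∪ -L)`, each fibre over `z` at
height `h > r` is contained in a translate, by a point of the fibre at height `r`, of the fibre
over `0` at height `h - r`. -/
def FiberRigid (K L : Set E) : Prop :=
  ∀ (z : E) (r h : ℝ),
    (∀ r' : ℝ, 0 ≤ r' → z ∈ r' • convexHull ℝ (K ∪ -L) → r ≤ r') → 0 ≤ r → r < h →
    ∀ p ∈ joinFiber K L r z, ∀ q ∈ joinFiber K L h z, q - p ∈ joinFiber K L (h - r) 0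

theorem mem_of_mem_smul_of_midpoint (hLc : IsCompact L)
    (hmid : Prod.snd '' joinFiber K L 2 0 ⊆ K ∩ L) {x : E} {T : ℝ} (hT : 0 ≤ T) (hxK : x ∈ K)
    (hxT : x ∈ T • L) (hL : Convex ℝ L) (hL0 : (0 : E) ∈ L) : x ∈ L := by
  obtain ⟨t, ht, hxt, hmin⟩ := exists_least_mem_smul hLc hT hxT
  -- The factor `s = 2 / (1 + t)` satisfies `2 - s = s * t`, so `s • x` lies in both `s • K` and `(2
  -- - s) • L`. Minimality of `t` then gives `t ≤ (1 + t) / 2`.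
  have h1 : (2 / (1 + t)) • x ∈ K ∩ L := by
    refine hmid ⟨(2 / (1 + t), (2 / (1 + t)) • x), ⟨by positivity, ?_,
      Set.smul_mem_smul_set hxK, ?_⟩, rfl⟩
    · rw [div_le_iff₀ (by positivity)]
      linarith
    · have := smul_mem_mul_smul (2 / (1 + t)) hxt
      convert this using 2
      · field_simp
        ring
      · simp
  have h2 : x ∈ ((1 + t) / 2) • L := by
    rw [Set.mem_smul_set_iff_inv_smul_mem₀ (by positivity), inv_div]
    exact h1.2
  have h3 := hmin _ (by positivity) h2
  have := mem_smul_of_le hL hL0 ht (b := 1) (by linarith) hxt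
  simpa using this

theorem FiberRigid.exists_least (hK : IsCompact K) (hL : IsCompact L)
    (hKc : Convex ℝ K) (hLc : Convex ℝ L) (hK0 : (0 : E) ∈ K) (hL0 : (0 : E) ∈ L)
    (hF : FiberRigid K L) {z : E} {h : ℝ} (hh : 0 ≤ h) (hne : (joinFiber K L h z).Nonempty) :
    ∃ r : ℝ, 0 ≤ r ∧ r ≤ h ∧ z ∈ r • convexHull ℝ (K ∪ -L) ∧ ∃ p ∈ joinFiber K L r z,
      ∀ h', r < h' → ∀ q ∈ joinFiber K L h' z, q - p ∈ joinFiber K L (h' - r) 0 := by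
  have h1 := (mem_smul_convexHull_union_neg hKc hLc hK0 hL0 hh).2 hne
  obtain ⟨r, hr, hzr, hmin⟩ := exists_least_mem_smul
    (isCompact_convexHull_union_neg hK hL hKc hLc hK0 hL0) hh h1
  obtain ⟨p, hp⟩ := (mem_smul_convexHull_union_neg hKc hLc hK0 hL0 hr).1 hzr
  exact ⟨r, hr, hmin _ hh h1, hzr, p, hp, fun h' hh' q hq => hF z r h' hmin hr hh' p hp q hq⟩

theorem eq_zero_of_neg_mem_joinFiber {p : ℝ × E} {a b : ℝ} {z w : E}
    (hp : p ∈ joinFiber K L a z) (hp' : 0 - p ∈ joinFiber K L b w) : p = 0 := by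
  have h1 : p.1 = 0 := by
    have := hp'.1
    simp only [zero_sub, Prod.fst_neg, Left.nonneg_neg_iff] at this
    exact le_antisymm this hp.1
  have h2 := hp.2.2.1
  rw [h1] at h2
  exact Prod.ext h1 (eq_zero_of_mem_zero_smul h2)

/-- It is enough to put `x` in some multiple of `L`. Over `z = -(T • c)`, with `c` interior to `L`
and `T` large, the origin lies in the fibre, so the translation is by `0`; rigidity then moves `(1,
x)` from the fibre over `z` to one over `0`. -/
theorem FiberRigid.subset (hK : IsCompact K) (hL : IsCompact L)
    (hKc : Convex ℝ K) (hLc : Convex ℝ L) (hK0 : (0 : E) ∈ K) (hL0 : (0 : E) ∈ L)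
    (hLi : (interior L).Nonempty) (hF : FiberRigid K L)
    (hmid : Prod.snd '' joinFiber K L 2 0 ⊆ K ∩ L) : K ⊆ L := by
  intro x hx
  obtain ⟨c, hc⟩ := hLi
  obtain ⟨ρ, hρ, hball⟩ := Metric.mem_nhds_iff.1 (mem_interior_iff_mem_nhds.1 hc)
  have hT0 : 0 < ‖x‖ / ρ + 1 := by positivity
  set T := ‖x‖ / ρ + 1 with hTdef
  have hxT : x + T • c ∈ T • L := by
    rw [Set.mem_smul_set_iff_inv_smul_mem₀ hT0.ne']
    apply hball
    rw [smul_add, inv_smul_smul₀ hT0.ne', Metric.mem_ball, dist_eq_norm, add_sub_cancel_right,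
      norm_smul, norm_inv, Real.norm_of_nonneg hT0.le, inv_mul_lt_iff₀ hT0, hTdef, add_mul,
      div_mul_cancel₀ _ hρ.ne']
    linarith
  have hcT : T • c ∈ T • L := Set.smul_mem_smul_set (interior_subset hc)
  have hq0 (h : ℝ) (hh : T + 1 ≤ h) : (0 : ℝ × E) ∈ joinFiber K L h (-(T • c)) := by
    refine ⟨le_rfl, by simp only [Prod.fst_zero]; linarith, ⟨0, hK0, by simp⟩, ?_⟩
    simp only [Prod.fst_zero, Prod.snd_zero, sub_zero, sub_neg_eq_add, zero_add]
    exact mem_smul_of_le hLc hL0 hT0.le (by linarith) hcT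
  obtain ⟨r, hr, hrT, -, p, hp, hrig⟩ := hF.exists_least hK hL hKc hLc hK0 hL0 (by positivity)
    ⟨_, hq0 (T + 1) le_rfl⟩
  have hp0 : p = 0 :=
    eq_zero_of_neg_mem_joinFiber hp (hrig (T + 2) (by linarith) _ (hq0 _ (by linarith)))
  have hq1 : ((1 : ℝ), x) ∈ joinFiber K L (T + 2) (-(T • c)) := by
    refine ⟨zero_le_one, by simp only; linarith, by simpa using hx, ?_⟩
    simp only [sub_neg_eq_add]
    exact mem_smul_of_le hLc hL0 hT0.le (by linarith) hxT
  have hfin := hrig (T + 2) (by linarith) _ hq1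
  rw [hp0, sub_zero] at hfin
  have h4 := hfin.2.2.2
  simp only [sub_zero] at h4
  exact mem_of_mem_smul_of_midpoint hL hmid (sub_nonneg.2 hfin.2.1) hx h4 hLc hL0

end FiberRigid

/-! ### For `K = L`: the lattice cone over `K` and its extreme rays. -/

section LatticeCone

variable {E : Type*} [NormedAddCommGroup E] [NormedSpace ℝ E] {K : Set E}

/-- The cone of all nonnegative multiples of points of `K`. -/
def conicSpan (K : Set E) : Set E := {x | ∃ s : ℝ, 0 ≤ s ∧ x ∈ s • K}

theorem zero_mem_conicSpan (hK0 : (0 : E) ∈ K) : (0 : E) ∈ conicSpan K :=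
  ⟨0, le_rfl, 0, hK0, by simp⟩

theorem add_mem_conicSpan (hK : Convex ℝ K) {x y : E} (hx : x ∈ conicSpan K)
    (hy : y ∈ conicSpan K) : x + y ∈ conicSpan K := by
  obtain ⟨s, hs, hx⟩ := hx
  obtain ⟨t, ht, hy⟩ := hy
  exact ⟨s + t, add_nonneg hs ht, add_mem_add_smul hK hs ht hx hy⟩

theorem smul_mem_conicSpan {c : ℝ} (hc : 0 ≤ c) {x : E} (hx : x ∈ conicSpan K) :
    c • x ∈ conicSpan K := by
  obtain ⟨s, hs, hx⟩ := hx
  exact ⟨c * s, mul_nonneg hc hs, smul_mem_mul_smul c hx⟩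

theorem subset_conicSpan : K ⊆ conicSpan K := fun x hx => ⟨1, zero_le_one, by simpa using hx⟩

theorem sum_mem_conicSpan (hK : Convex ℝ K) (hK0 : (0 : E) ∈ K) {ι : Type*} (s : Finset ι)
    {f : ι → E} (hf : ∀ i ∈ s, f i ∈ conicSpan K) : ∑ i ∈ s, f i ∈ conicSpan K :=
  Finset.sum_induction f (· ∈ conicSpan K) (fun _ _ => add_mem_conicSpan hK)
    (zero_mem_conicSpan hK0) hf

/-- The cone is pointed: the origin lies in the fibre over `u`, so the translation is by `0`, and
the point `u` at full height leaves no room for `r > 0`. -/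
theorem FiberRigid.eq_zero_of_neg_mem (hK : IsCompact K) (hKc : Convex ℝ K) (hK0 : (0 : E) ∈ K)
    (hF : FiberRigid K K) {u : E} (hu : u ∈ conicSpan K) (hu' : -u ∈ conicSpan K) : u = 0 := by
  obtain ⟨s, hs, hu⟩ := hu
  obtain ⟨a, ha, hu'⟩ := hu'
  have h0 (h : ℝ) (hh : a ≤ h) : (0 : ℝ × E) ∈ joinFiber K K h u := by
    refine ⟨le_rfl, ha.trans hh, ⟨0, hK0, by simp⟩, ?_⟩
    simp only [Prod.fst_zero, Prod.snd_zero, sub_zero, zero_sub]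
    exact mem_smul_of_le hKc hK0 ha hh hu'
  obtain ⟨r, hr, hra, hur, p, hp, hrig⟩ := hF.exists_least hK hK hKc hKc hK0 hK0 ha
    ⟨_, h0 a le_rfl⟩
  have hp0 : p = 0 := eq_zero_of_neg_mem_joinFiber hp
    (hrig (a + s + 1) (by linarith) _ (h0 _ (by linarith)))
  have hq : ((a + s + 1 : ℝ), u) ∈ joinFiber K K (a + s + 1) u := by
    refine ⟨by positivity, le_rfl, mem_smul_of_le hKc hK0 hs (by linarith) hu, ?_⟩
    exact ⟨0, hK0, by simp⟩
  have h1 := (hrig (a + s + 1) (by linarith) _ hq).2.1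
  rw [hp0, sub_zero] at h1
  simp only at h1
  obtain rfl : r = 0 := by linarith
  exact eq_zero_of_mem_zero_smul hur

/-- In the cone order the gauge of `K` behaves additively. Pointedness identifies the least fibre
point over `q` as `(a, q)`, and rigidity is then read at `(s, x)`. -/
theorem FiberRigid.sub_mem_smul (hK : IsCompact K) (hKc : Convex ℝ K) (hK0 : (0 : E) ∈ K)
    (hF : FiberRigid K K) {q x : E} {a s : ℝ} (ha : 0 ≤ a) (hqa : q ∈ a • K)
    (hmin : ∀ r' : ℝ, 0 ≤ r' → q ∈ r' • K → a ≤ r') (hs : 0 ≤ s) (hx : x ∈ s • K)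
    (hxq : x - q ∈ conicSpan K) : a ≤ s ∧ x - q ∈ (s - a) • K := by
  obtain ⟨t, ht, hxq⟩ := hxq
  have hq (h : ℝ) (hh : a ≤ h) : ((a : ℝ), q) ∈ joinFiber K K h q :=
    ⟨ha, hh, hqa, 0, hK0, by simp⟩
  obtain ⟨r, hr, hra, -, p, hp, hrig⟩ := hF.exists_least hK hK hKc hKc hK0 hK0 ha ⟨_, hq a le_rfl⟩
  have h1 := hrig (a + s + t + 1) (by linarith) _ (hq _ (by linarith))
  have hx' : ((s : ℝ), x) ∈ joinFiber K K (a + s + t + 1) q :=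
    ⟨hs, by simp only; linarith, hx, mem_smul_of_le hKc hK0 ht (by simp only; linarith) hxq⟩
  have h2 := hrig (a + s + t + 1) (by linarith) _ hx'
  obtain ⟨g1, g2, g3, g4⟩ := h1
  obtain ⟨p1, p2, p3, p4⟩ := hp
  obtain ⟨k1, k2, k3, k4⟩ := h2
  simp only [Prod.fst_sub, Prod.snd_sub, sub_zero] at g1 g2 g3 g4 k1 k2 k3 k4
  have hpq : p.2 = q := by
    have := hF.eq_zero_of_neg_mem hK hKc hK0 (u := p.2 - q) ⟨_, by linarith, p4⟩
      ⟨_, g1, by simpa using g3⟩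
    exact sub_eq_zero.1 this
  rw [hpq] at p3 k3
  have hpa : p.1 = a := le_antisymm (by linarith) (hmin _ p1 p3)
  rw [hpa] at k1 k3
  exact ⟨by linarith, k3⟩

/-- The least fibre point over `z` supplies the supremum of `0` and `z` in the cone order. -/
theorem FiberRigid.exists_sup (hK : IsCompact K) (hKc : Convex ℝ K) (hK0 : (0 : E) ∈ K)
    (hF : FiberRigid K K) {z y₀ : E} (hy₀ : y₀ ∈ conicSpan K) (hy₀z : y₀ - z ∈ conicSpan K) :
    ∃ q ∈ conicSpan K, q - z ∈ conicSpan K ∧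
      ∀ y ∈ conicSpan K, y - z ∈ conicSpan K → y - q ∈ conicSpan K := by
  obtain ⟨s, hs, hy₀⟩ := hy₀
  obtain ⟨t, ht, hy₀z⟩ := hy₀z
  have h0 : (s, y₀) ∈ joinFiber K K (s + t) z :=
    ⟨hs, by simp only; linarith, hy₀, by simpa using hy₀z⟩
  obtain ⟨r, hr, -, -, p, ⟨p1, p2, p3, p4⟩, hrig⟩ :=
    hF.exists_least hK hK hKc hKc hK0 hK0 (add_nonneg hs ht) ⟨_, h0⟩
  refine ⟨p.2, ⟨_, p1, p3⟩, ⟨_, sub_nonneg.2 p2, p4⟩, ?_⟩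
  rintro y ⟨s', hs', hy⟩ ⟨t', ht', hyz⟩
  have h1 : (s', y) ∈ joinFiber K K (s' + t' + r + 1) z :=
    ⟨hs', by simp only; linarith, hy, mem_smul_of_le hKc hK0 ht' (by simp only; linarith) hyz⟩
  have h2 := hrig _ (by linarith) _ h1
  exact ⟨_, h2.1, h2.2.2.1⟩

theorem FiberRigid.exists_riesz_decomposition (hK : IsCompact K) (hKc : Convex ℝ K)
    (hK0 : (0 : E) ∈ K) (hF : FiberRigid K K) {x a b : E} (hx : x ∈ conicSpan K)
    (ha : a ∈ conicSpan K) (hb : b ∈ conicSpan K) (habx : a + b - x ∈ conicSpan K) :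
    ∃ u ∈ conicSpan K, x - u ∈ conicSpan K ∧ a - u ∈ conicSpan K ∧ b - (x - u) ∈ conicSpan K := by
  -- With `q = sup(0, x - a)`, the element `x - q` is the infimum of `x` and `a`.
  obtain ⟨q, hq, hqz, hmin⟩ := hF.exists_sup hK hKc hK0 (z := x - a) hx (by simpa using ha)
  refine ⟨x - q, hmin x hx (by simpa using ha), by simpa using hq, ?_, ?_⟩
  · rwa [show a - (x - q) = q - (x - a) by abel]
  · rw [sub_sub_cancel]
    refine hmin b hb ?_
    rwa [← sub_add, sub_add_eq_add_sub, add_comm b a]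

/-- Extreme points span extreme rays: if `u` has gauge `s` strictly between `0` and `1`, then `e` is
a convex combination of `u / s` and `(e - u) / (1 - s)`, both in `K`. -/
theorem FiberRigid.eq_smul_of_sub_mem (hK : IsCompact K) (hKc : Convex ℝ K)
    (hK0 : (0 : E) ∈ K) (hF : FiberRigid K K) {e u : E} (he : e ∈ Set.extremePoints ℝ K) {α : ℝ}
    (hα : 0 ≤ α) (hu : u ∈ conicSpan K) (hue : α • e - u ∈ conicSpan K) :
    ∃ c : ℝ, 0 ≤ c ∧ u = c • e := by
  rcases hα.eq_or_lt with rfl | hα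
  · refine ⟨0, le_rfl, ?_⟩
    rw [zero_smul, zero_sub] at hue
    rw [hF.eq_zero_of_neg_mem hK hKc hK0 hu hue, zero_smul]
  · suffices ∀ u ∈ conicSpan K, e - u ∈ conicSpan K → ∃ c : ℝ, 0 ≤ c ∧ u = c • e by
      obtain ⟨c, hc, hcu⟩ := this (α⁻¹ • u) (smul_mem_conicSpan (inv_nonneg.2 hα.le) hu) (by
        have := smul_mem_conicSpan (inv_nonneg.2 hα.le) hue
        rwa [smul_sub, inv_smul_smul₀ hα.ne'] at this)
      refine ⟨α * c, by positivity, ?_⟩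
      rw [mul_smul, ← hcu, smul_inv_smul₀ hα.ne']
    rintro u ⟨s₀, hs₀, hu⟩ hue
    obtain ⟨s, hs, hus, hmin⟩ := exists_least_mem_smul hK hs₀ hu
    obtain ⟨hs1, h2⟩ := hF.sub_mem_smul hK hKc hK0 hs hus hmin zero_le_one
      (by simpa using he.1) hue
    rcases hs.eq_or_lt with rfl | hs0
    · exact ⟨0, le_rfl, by simpa using eq_zero_of_mem_zero_smul hus⟩
    rcases hs1.eq_or_lt with rfl | hs1
    · rw [sub_self] at h2
      exact ⟨1, zero_le_one, by simpa using (sub_eq_zero.1 (eq_zero_of_mem_zero_smul h2)).symm⟩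
    obtain ⟨x, hx, rfl⟩ := hus
    obtain ⟨y, hy, hxy⟩ := h2
    have h3 : e ∈ openSegment ℝ x y := ⟨s, 1 - s, hs0, sub_pos.2 hs1, by ring, by
      simp only at hxy
      rw [hxy]
      abel⟩
    exact ⟨s, hs, by rw [he.2 hx hy h3]⟩

theorem eq_of_eq_smul_extremePoints (hK0 : (0 : E) ∈ K) {e e' : E}
    (he : e ∈ Set.extremePoints ℝ K) (he' : e' ∈ Set.extremePoints ℝ K) {c : ℝ} (hc : 0 < c)
    (hee : e' = c • e) : e = e' := by
  rcases lt_trichotomy c 1 with h | rfl | h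
  · exact he'.2 he.1 hK0 ⟨c, 1 - c, hc, sub_pos.2 h, by ring, by simp [hee]⟩
  · simpa using hee.symm
  · refine (he.2 he'.1 hK0 ⟨c⁻¹, 1 - c⁻¹, inv_pos.2 hc, sub_pos.2 (inv_lt_one_of_one_lt₀ h),
      by ring, ?_⟩).symm
    rw [hee, inv_smul_smul₀ hc.ne', smul_zero, add_zero]

/-- Riesz decomposition splits off from `α • e` a part below `β j • j`; it lies on two distinct
extreme rays, so it vanishes and the term `j` can be dropped. -/
theorem FiberRigid.coeff_eq_zero (hK : IsCompact K) (hKc : Convex ℝ K)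
    (hK0 : (0 : E) ∈ K) (hF : FiberRigid K K) {e : E} (he : e ∈ Set.extremePoints ℝ K)
    (he0 : e ≠ 0) {α : ℝ} (hα : 0 ≤ α) {β : E → ℝ} (hβ : ∀ j, 0 ≤ β j) (s : Finset E)
    (hs : ∀ j ∈ s, j ∈ Set.extremePoints ℝ K ∧ j ≠ e) (h : ∑ j ∈ s, β j • j - α • e ∈ conicSpan K) :
    α = 0 := by
  classical
  have hαe : α • e ∈ conicSpan K := smul_mem_conicSpan hα (subset_conicSpan he.1)
  induction s using Finset.induction_on with
  | empty =>
    simp only [Finset.sum_empty, zero_sub] at h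
    have := hF.eq_zero_of_neg_mem hK hKc hK0 hαe h
    simpa [he0] using this
  | insert j s hjs ih =>
    rw [Finset.sum_insert hjs] at h
    have hmem (i) (hi : i ∈ insert j s) : β i • i ∈ conicSpan K :=
      smul_mem_conicSpan (hβ i) (subset_conicSpan (hs i hi).1.1)
    obtain ⟨u, hu, h1, h2, h3⟩ := hF.exists_riesz_decomposition hK hKc hK0 hαe
      (hmem j (Finset.mem_insert_self j s))
      (sum_mem_conicSpan hKc hK0 s fun i hi => hmem i (Finset.mem_insert_of_mem hi)) h
    obtain ⟨hj, hje⟩ := hs j (Finset.mem_insert_self j s)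
    obtain ⟨c, hc, hcu⟩ := hF.eq_smul_of_sub_mem hK hKc hK0 he hα hu h1
    obtain ⟨c', hc', hcu'⟩ := hF.eq_smul_of_sub_mem hK hKc hK0 hj (hβ j) hu h2
    have hu0 : u = 0 := by
      rcases hc.eq_or_lt with rfl | hc
      · simpa using hcu
      rcases hc'.eq_or_lt with rfl | hc'
      · simpa using hcu'
      refine absurd (eq_of_eq_smul_extremePoints hK0 hj he (div_pos hc' hc) ?_) hje
      rw [div_eq_inv_mul, mul_smul, ← hcu', hcu, inv_smul_smul₀ hc.ne']
    rw [hu0, sub_zero] at h3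
    exact ih (fun i hi => hs i (Finset.mem_insert_of_mem hi)) h3

theorem FiberRigid.linearIndepOn_extremePoints (hK : IsCompact K) (hKc : Convex ℝ K)
    (hK0 : (0 : E) ∈ K) (hF : FiberRigid K K) :
    LinearIndepOn ℝ id (Set.extremePoints ℝ K \ {0}) := by
  classical
  have key (s : Finset E) (hs : (s : Set E) ⊆ Set.extremePoints ℝ K \ {0}) (g : E → ℝ)
      (hg : ∑ j ∈ s, g j • j = 0) (i : E) (hi : i ∈ s) : g i ≤ 0 := by
    by_contra! hpos
    -- Discarding the terms with positive coefficient bounds `g i • i` by the sum of the negative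
    -- parts of the other terms.
    refine hpos.ne' (hF.coeff_eq_zero hK hKc hK0 (hs hi).1 (hs hi).2 hpos.le
      (β := fun j => max (-g j) 0) (fun j => le_max_right _ _) (s.erase i)
      (fun j hj => ⟨(hs (Finset.mem_of_mem_erase hj)).1, Finset.ne_of_mem_erase hj⟩) ?_)
    rw [← Finset.add_sum_erase s _ hi] at hg
    rw [sub_eq_add_neg, neg_eq_of_add_eq_zero_right hg, ← Finset.sum_add_distrib]
    refine sum_mem_conicSpan hKc hK0 _ fun j hj => ?_
    rw [← add_smul]
    refine smul_mem_conicSpan ?_ (subset_conicSpan (hs (Finset.mem_of_mem_erase hj)).1.1)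
    linarith [le_max_left (-g j) 0]
  rw [linearIndepOn_iff']
  intro s g hs hg i hi
  refine le_antisymm (key s hs g hg i hi) ?_
  have := key s hs (-g) (by simpa using hg) i hi
  simpa using this

end LatticeCone

/-! ### Simplices with a vertex at the origin, in terms of bases. -/

section Simplex

variable {n : ℕ}

theorem isSimplexWithVertexZero_of_basis {K : Set (EuclideanSpace ℝ (Fin n))}
    (b : Module.Basis (Fin n) ℝ (EuclideanSpace ℝ (Fin n)))
    (hK : K = convexHull ℝ (insert 0 (Set.range b))) : IsSimplexWithVertexZero K := by
  have haff : AffineIndependent ℝ (Fin.cons 0 b : Fin (n + 1) → EuclideanSpace ℝ (Fin n)) := by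
    rw [affineIndependent_iff_linearIndependent_vsub ℝ _ (0 : Fin (n + 1)),
      ← linearIndependent_equiv (finSuccAboveEquiv (0 : Fin (n + 1)))]
    have h : ((fun x : {x : Fin (n + 1) // x ≠ 0} =>
        (Fin.cons 0 b : Fin (n + 1) → EuclideanSpace ℝ (Fin n)) x -ᵥ
          (Fin.cons 0 b : Fin (n + 1) → EuclideanSpace ℝ (Fin n)) 0) ∘
        finSuccAboveEquiv (0 : Fin (n + 1))) = b := by
      ext i
      simp [finSuccAboveEquiv]
    rw [h]
    exact b.linearIndependent
  refine ⟨⟨Fin.cons 0 b, haff⟩, ?_, 0, rfl⟩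
  rw [hK]
  simp only [Fin.range_cons]

theorem IsSimplexWithVertexZero.exists_basis {K : Set (EuclideanSpace ℝ (Fin n))}
    (hK : IsSimplexWithVertexZero K) :
    ∃ b : Module.Basis (Fin n) ℝ (EuclideanSpace ℝ (Fin n)),
      K = convexHull ℝ (insert 0 (Set.range b)) := by
  obtain ⟨s, rfl, i, hi⟩ := hK
  have h1 := (affineIndependent_iff_linearIndependent_vsub ℝ _ i).1 s.independent
  rw [← linearIndependent_equiv (finSuccAboveEquiv i)] at h1
  have h2 : ((fun x : {x // x ≠ i} => s.points x -ᵥ s.points i) ∘ finSuccAboveEquiv i) =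
      s.points ∘ i.succAbove := by
    ext j
    simp [finSuccAboveEquiv, hi]
  rw [h2] at h1
  refine ⟨basisOfLinearIndependentOfCardEqFinrank' _ h1 (by simp), ?_⟩
  rw [coe_basisOfLinearIndependentOfCardEqFinrank', Set.range_comp, Fin.range_succAbove, ← hi,
    ← Set.image_insert_eq]
  congr 1
  rw [← Set.image_univ]
  congr 1
  ext j
  simp [em]

/-- Independence makes the extreme points finite in number, Krein–Milman recovers `K` from them, and
the nonempty interior makes the nonzero ones a basis. -/
theorem FiberRigid.isSimplexWithVertexZero {K : Set (EuclideanSpace ℝ (Fin n))}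
    (hK : IsCompact K) (hKc : Convex ℝ K) (hK0 : 0 ∈ K) (hKi : (interior K).Nonempty)
    (hF : FiberRigid K K) : IsSimplexWithVertexZero K := by
  set S := Set.extremePoints ℝ K \ {0} with hS
  have hli : LinearIndepOn ℝ id S := hF.linearIndepOn_extremePoints hK hKc hK0
  have hfin : S.Finite := hli.setFinite
  have hKS : K = convexHull ℝ (insert 0 S) := by
    refine Set.Subset.antisymm ?_ (convexHull_min ?_ hKc)
    · have h1 := closure_convexHull_extremePoints hK hKc
      rw [← ((hfin.insert 0).isClosed_convexHull ℝ).closure_eq]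
      conv_lhs => rw [← h1]
      refine closure_mono (convexHull_mono fun x hx => ?_)
      by_cases h0 : x = 0
      · exact Or.inl h0
      · exact Or.inr ⟨hx, h0⟩
    · rintro x (rfl | hx)
      · exact hK0
      · exact hx.1.1
  have hspan : Submodule.span ℝ S = ⊤ := by
    refine Submodule.eq_top_of_nonempty_interior' _ (hKi.mono (interior_mono ?_))
    conv_lhs => rw [hKS]
    refine convexHull_min ?_ (Submodule.convex _)
    rintro x (rfl | hx)
    · exact zero_mem _
    · exact Submodule.subset_span hx
  let b := Module.Basis.mk hli (by simp [hspan])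
  have := hfin.fintype
  have hcard : Fintype.card S = n := by
    rw [← Module.finrank_eq_card_basis b]
    simp
  refine isSimplexWithVertexZero_of_basis (b.reindex (Fintype.equivFinOfCardEq hcard)) ?_
  conv_lhs => rw [hKS]
  have hb : ⇑b = fun x : S => id (x : EuclideanSpace ℝ (Fin n)) := Module.Basis.coe_mk hli _
  rw [Module.Basis.range_reindex, hb]
  simp only [id_eq, Subtype.range_coe]

end Simplex

/-! ### Volume of the hull of a simplex and its reflection. -/

section CrossPolytope

variable {n : ℕ} {E : Type*} [NormedAddCommGroup E] [NormedSpace ℝ E]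

/-- The linear map that changes the signs of the coordinates according to `ε`. -/
noncomputable def signFlip (b : Module.Basis (Fin n) ℝ E) (ε : Fin n → ℤˣ) : E →ₗ[ℝ] E :=
  b.constr ℝ fun i => ((ε i : ℤ) : ℝ) • b i

theorem repr_signFlip (b : Module.Basis (Fin n) ℝ E) (ε : Fin n → ℤˣ) (x : E) (i : Fin n) :
    b.repr (signFlip b ε x) i = ((ε i : ℤ) : ℝ) * b.repr x i := by
  rw [signFlip, Module.Basis.constr_apply_fintype]
  simp [Finsupp.single_apply, mul_comm]

theorem abs_det_signFlip (b : Module.Basis (Fin n) ℝ E) (ε : Fin n → ℤˣ) :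
    |LinearMap.det (signFlip b ε)| = 1 := by
  have h : LinearMap.toMatrix b b (signFlip b ε) = Matrix.diagonal fun i => ((ε i : ℤ) : ℝ) := by
    ext i j
    rw [LinearMap.toMatrix_apply, repr_signFlip, Matrix.diagonal_apply]
    by_cases hij : i = j
    · simp [hij]
    · simp [hij]
  rw [← LinearMap.det_toMatrix b, h, Matrix.det_diagonal, Finset.abs_prod]
  refine Finset.prod_eq_one fun i _ => ?_
  rcases Int.units_eq_one_or (ε i) with h | h <;> simp [h]

theorem repr_nonneg_of_mem_convexHull (b : Module.Basis (Fin n) ℝ E) {x : E}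
    (hx : x ∈ convexHull ℝ (insert 0 (Set.range b))) (i : Fin n) : 0 ≤ b.repr x i := by
  have : convexHull ℝ (insert 0 (Set.range b)) ⊆ {x | 0 ≤ b.coord i x} := by
    refine convexHull_min ?_ (convex_halfSpace_ge (b.coord i).isLinear 0)
    rintro _ (rfl | ⟨j, rfl⟩)
    · simp
    · by_cases hij : j = i <;> simp [hij]
  exact this hx

theorem repr_pos_of_mem_interior (b : Module.Basis (Fin n) ℝ E) {x : E}
    (hx : x ∈ interior (convexHull ℝ (insert 0 (Set.range b)))) (i : Fin n) :
    0 < b.repr x i := by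
  have hc : Filter.Tendsto (fun t : ℝ => x - t • b i) (nhdsWithin 0 (Set.Ioi 0)) (nhds x) := by
    have : Continuous fun t : ℝ => x - t • b i := by fun_prop
    have h := this.tendsto 0
    rw [zero_smul, sub_zero] at h
    exact h.mono_left nhdsWithin_le_nhds
  obtain ⟨t, ht, ht0⟩ := ((hc.eventually_mem (mem_interior_iff_mem_nhds.1 hx)).and
    self_mem_nhdsWithin).exists
  have := repr_nonneg_of_mem_convexHull b ht i
  simp only [map_sub, map_smul, Module.Basis.repr_self, Finsupp.coe_sub, Finsupp.coe_smul,
    Pi.sub_apply, Pi.smul_apply, Finsupp.single_eq_same, smul_eq_mul, mul_one] at this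
  have ht0 : 0 < t := ht0
  linarith

theorem signFlip_image_subset (b : Module.Basis (Fin n) ℝ E) (ε : Fin n → ℤˣ) :
    signFlip b ε '' convexHull ℝ (insert 0 (Set.range b)) ⊆
      convexHull ℝ (convexHull ℝ (insert 0 (Set.range b)) ∪
        -convexHull ℝ (insert 0 (Set.range b))) := by
  rw [LinearMap.image_convexHull]
  refine convexHull_min ?_ (convex_convexHull ℝ _)
  rintro _ ⟨_, rfl | ⟨j, rfl⟩, rfl⟩
  · rw [map_zero]
    exact subset_convexHull ℝ _ (Or.inl (subset_convexHull ℝ _ (Or.inl rfl)))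
  · have hb : b j ∈ convexHull ℝ (insert 0 (Set.range b)) :=
      subset_convexHull ℝ _ (Or.inr ⟨j, rfl⟩)
    rw [signFlip, Module.Basis.constr_basis]
    apply subset_convexHull ℝ _
    rcases Int.units_eq_one_or (ε j) with h | h
    · left
      simpa [h] using hb
    · right
      simpa [h] using hb

/-- The `2ⁿ` coordinate sign changes preserve volume and send the interior of the simplex into
distinct open orthants, all inside the hull. -/
theorem two_pow_mul_measure_simplex_le [FiniteDimensional ℝ E] [MeasurableSpace E] [BorelSpace E]
    (μ : Measure E) [μ.IsAddHaarMeasure] (b : Module.Basis (Fin n) ℝ E) :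
    2 ^ n * μ (convexHull ℝ (insert 0 (Set.range b))) ≤
      μ (convexHull ℝ (convexHull ℝ (insert 0 (Set.range b)) ∪
        -convexHull ℝ (insert 0 (Set.range b)))) := by
  set K := convexHull ℝ (insert 0 (Set.range b)) with hK
  have hint : μ (interior K) = μ K := by
    refine le_antisymm (measure_mono interior_subset) ?_
    calc μ K ≤ μ (interior K ∪ frontier K) := measure_mono (by
          rw [← closure_eq_interior_union_frontier]
          exact subset_closure)
      _ ≤ μ (interior K) + μ (frontier K) := measure_union_le _ _
      _ = μ (interior K) := by rw [(convex_convexHull ℝ _).addHaar_frontier μ, add_zero]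
  have hvol (ε : Fin n → ℤˣ) : μ (signFlip b ε '' interior K) = μ K := by
    rw [Measure.addHaar_image_linearMap, abs_det_signFlip, hint]
    simp
  have hdet (ε : Fin n → ℤˣ) : LinearMap.det (signFlip b ε) ≠ 0 := by
    intro h
    simpa [h] using abs_det_signFlip b ε
  have hmeas (ε : Fin n → ℤˣ) : MeasurableSet (signFlip b ε '' interior K) := by
    have h := ((LinearMap.equivOfDetNeZero _ (hdet ε)).toContinuousLinearEquiv).toHomeomorph.isOpenMap
      _ (isOpen_interior (s := K))
    exact h.measurableSet
  have hdisj : Pairwise (Function.onFun Disjoint fun ε : Fin n → ℤˣ =>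
      signFlip b ε '' interior K) := by
    intro ε δ hεδ
    rw [Function.onFun, Set.disjoint_left]
    rintro _ ⟨x, hx, rfl⟩ ⟨y, hy, hxy⟩
    obtain ⟨i, hi⟩ := Function.ne_iff.1 hεδ
    have h1 := congrArg (fun v => b.repr v i) hxy
    simp only [repr_signFlip] at h1
    have hx' := repr_pos_of_mem_interior b hx i
    have hy' := repr_pos_of_mem_interior b hy i
    rcases Int.units_eq_one_or (ε i) with h | h <;> rcases Int.units_eq_one_or (δ i) with h' | h' <;>
      simp only [h, h', ne_eq, not_true_eq_false] at hi h1 <;> simp at h1 <;> linarith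
  calc 2 ^ n * μ K = ∑ ε : Fin n → ℤˣ, μ (signFlip b ε '' interior K) := by
        simp [hvol]
    _ = μ (⋃ ε : Fin n → ℤˣ, signFlip b ε '' interior K) := by
        rw [measure_iUnion hdisj hmeas, tsum_fintype]
    _ ≤ _ := measure_mono (Set.iUnion_subset fun ε =>
        (Set.image_mono interior_subset).trans (signFlip_image_subset b ε))

end CrossPolytope

/-! ### Equality yields rigidity and `K = L`. -/

section EqualityCase

variable {E : Type*} [NormedAddCommGroup E] [NormedSpace ℝ E] {K L : Set E}

theorem convexHull_union_neg_mem_nhds_zero (h : (interior (K ∩ L)).Nonempty) :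
    convexHull ℝ (K ∪ -L) ∈ nhds 0 := by
  obtain ⟨c, hc⟩ := h
  have hcont : Filter.Tendsto (fun x : E => c + (2 : ℝ) • x) (nhds 0) (nhds c) := by
    have : Continuous fun x : E => c + (2 : ℝ) • x := by fun_prop
    simpa using this.tendsto 0
  filter_upwards [hcont (mem_interior_iff_mem_nhds.1 hc)] with x hx
  have h1 : c + (2 : ℝ) • x ∈ convexHull ℝ (K ∪ -L) := subset_convexHull ℝ _ (Or.inl hx.1)
  have h2 : -c ∈ convexHull ℝ (K ∪ -L) :=
    subset_convexHull ℝ _ (Or.inr (by simpa using (interior_subset hc).2))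
  have := convex_convexHull ℝ (K ∪ -L) h1 h2 (a := 1 / 2) (b := 1 / 2) (by norm_num) (by norm_num)
    (by norm_num)
  -- Here `x` is the midpoint of `c + 2 • x ∈ K` and `-c ∈ -L`.
  convert this using 1
  module

theorem convexHull_union_neg_swap (K L : Set E) :
    convexHull ℝ (L ∪ -K) = -convexHull ℝ (K ∪ -L) := by
  rw [← convexHull_neg, Set.union_neg, neg_neg, Set.union_comm]

variable [FiniteDimensional ℝ E] [MeasurableSpace E] [BorelSpace E] (μ : Measure E)
  [μ.IsAddHaarMeasure]

/-- Equality holds throughout the chain: in the upper bound it gives rigidity, and in the lower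
bound, after cancelling the volume of the hull, it identifies the projected fibre with `K ∩ L`. -/
theorem fiberRigid_of_measure_eq (hK : IsCompact K) (hL : IsCompact L)
    (hKc : Convex ℝ K) (hLc : Convex ℝ L) (hK0 : (0 : E) ∈ K) (hL0 : (0 : E) ∈ L)
    (hKi : (interior K).Nonempty) (hLi : (interior L).Nonempty)
    (heq : μ (K ∩ L) * μ (convexHull ℝ (K ∪ -L)) = 2 ^ Module.finrank ℝ E * μ K * μ L) :
    FiberRigid K L ∧ Prod.snd '' joinFiber K L 2 0 ⊆ K ∩ L := by
  have hsub := inter_subset_snd_image_joinFiber K L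
  have h1 := measure_mul_measure_convexHull_le μ hK hL hKc hLc hK0 hL0
  have h2 : μ (K ∩ L) * μ (convexHull ℝ (K ∪ -L)) ≤
      μ (Prod.snd '' joinFiber K L 2 0) * μ (convexHull ℝ (K ∪ -L)) :=
    mul_le_mul_left (measure_mono hsub) _
  have hpos : 2 ^ Module.finrank ℝ E * μ K * μ L ≠ 0 :=
    mul_ne_zero (mul_ne_zero (by positivity)
      (Measure.measure_pos_of_nonempty_interior μ hKi).ne')
      (Measure.measure_pos_of_nonempty_interior μ hLi).ne'
  have hN0 : μ (K ∩ L) ≠ 0 := left_ne_zero_of_mul (heq ▸ hpos)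
  have hA0 : μ (convexHull ℝ (K ∪ -L)) ≠ 0 := right_ne_zero_of_mul (heq ▸ hpos)
  have hAt : μ (convexHull ℝ (K ∪ -L)) ≠ ⊤ :=
    (isCompact_convexHull_union_neg hK hL hKc hLc hK0 hL0).measure_lt_top.ne
  have hNi := nonempty_interior_of_measure_ne_zero μ (hKc.inter hLc) hN0
  constructor
  · intro z r h hmin hr hrh p hp q hq
    exact sub_mem_joinFiber_of_measure_eq μ hK hL hKc hLc hK0 hL0
      (convexHull_union_neg_mem_nhds_zero hNi) (le_antisymm h1 (heq ▸ h2)) hKi hLi hmin hr hrh hp hq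
  · have hM : Convex ℝ (Prod.snd '' joinFiber K L 2 0) :=
      (convex_joinFiber hKc hLc 2 0).linear_image (LinearMap.snd ℝ ℝ E)
    refine subset_of_measure_le μ (hK.inter hL).isClosed hM hsub hN0
      (hK.inter hL).measure_lt_top.ne ?_
    rwa [← heq, ENNReal.mul_le_mul_iff_left hA0 hAt] at h1

theorem subset_of_measure_eq (hK : IsCompact K) (hL : IsCompact L)
    (hKc : Convex ℝ K) (hLc : Convex ℝ L) (hK0 : (0 : E) ∈ K) (hL0 : (0 : E) ∈ L)
    (hKi : (interior K).Nonempty) (hLi : (interior L).Nonempty)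
    (heq : μ (K ∩ L) * μ (convexHull ℝ (K ∪ -L)) = 2 ^ Module.finrank ℝ E * μ K * μ L) :
    K ⊆ L := by
  obtain ⟨hF, hmid⟩ := fiberRigid_of_measure_eq μ hK hL hKc hLc hK0 hL0 hKi hLi heq
  exact hF.subset hK hL hKc hLc hK0 hL0 hLi hmid

theorem eq_of_measure_eq (hK : IsCompact K) (hL : IsCompact L)
    (hKc : Convex ℝ K) (hLc : Convex ℝ L) (hK0 : (0 : E) ∈ K) (hL0 : (0 : E) ∈ L)
    (hKi : (interior K).Nonempty) (hLi : (interior L).Nonempty)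
    (heq : μ (K ∩ L) * μ (convexHull ℝ (K ∪ -L)) = 2 ^ Module.finrank ℝ E * μ K * μ L) :
    K = L := by
  refine (subset_of_measure_eq μ hK hL hKc hLc hK0 hL0 hKi hLi heq).antisymm
    (subset_of_measure_eq μ hL hK hLc hKc hL0 hK0 hLi hKi ?_)
  rw [convexHull_union_neg_swap, Measure.measure_neg, Set.inter_comm, heq]
  ring

end EqualityCase

/-! ### The main theorem. -/

theorem mainTheorem5 (n : ℕ) (K L : ConvexBody (EuclideanSpace ℝ (Fin n)))
    (hK : (interior (K : Set (EuclideanSpace ℝ (Fin n)))).Nonempty)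
    (hL : (interior (L : Set (EuclideanSpace ℝ (Fin n)))).Nonempty)
    (hK0 : (0 : EuclideanSpace ℝ (Fin n)) ∈ K) (hL0 : (0 : EuclideanSpace ℝ (Fin n)) ∈ L) :
    volume ((K : Set (EuclideanSpace ℝ (Fin n))) ∩ L) *
          volume (convexHull ℝ ((K : Set (EuclideanSpace ℝ (Fin n))) ∪ -L)) ≤
        volume (polarSet ((2⁻¹ : ℝ) • (polarSet (K : Set (EuclideanSpace ℝ (Fin n))) +
            polarSet (L : Set (EuclideanSpace ℝ (Fin n)))))) *
          volume (convexHull ℝ ((K : Set (EuclideanSpace ℝ (Fin n))) ∪ -L)) ∧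
      volume (polarSet ((2⁻¹ : ℝ) • (polarSet (K : Set (EuclideanSpace ℝ (Fin n))) +
            polarSet (L : Set (EuclideanSpace ℝ (Fin n)))))) *
          volume (convexHull ℝ ((K : Set (EuclideanSpace ℝ (Fin n))) ∪ -L)) ≤
        2 ^ n * volume (K : Set (EuclideanSpace ℝ (Fin n))) *
          volume (L : Set (EuclideanSpace ℝ (Fin n))) ∧
      (volume ((K : Set (EuclideanSpace ℝ (Fin n))) ∩ L) *
            volume (convexHull ℝ ((K : Set (EuclideanSpace ℝ (Fin n))) ∪ -L)) =
          2 ^ n * volume (K : Set (EuclideanSpace ℝ (Fin n))) *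
            volume (L : Set (EuclideanSpace ℝ (Fin n))) ↔
        K = L ∧ IsSimplexWithVertexZero (K : Set (EuclideanSpace ℝ (Fin n)))) := by
  have hKL := measure_mul_measure_convexHull_le volume K.isCompact L.isCompact K.convex L.convex
    hK0 hL0
  have hle := mul_le_mul_left (measure_mono (μ := volume) (inter_subset_snd_image_joinFiber
    (K : Set (EuclideanSpace ℝ (Fin n))) L))
    (volume (convexHull ℝ ((K : Set (EuclideanSpace ℝ (Fin n))) ∪ -L)))
  rw [finrank_euclideanSpace_fin] at hKL
  rw [polarSet_half_add_eq K.convex L.convex K.isCompact L.isCompact hK0 hL0]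
  refine ⟨hle, hKL, fun heq => ?_, ?_⟩
  · have heq' : volume ((K : Set (EuclideanSpace ℝ (Fin n))) ∩ L) *
        volume (convexHull ℝ ((K : Set (EuclideanSpace ℝ (Fin n))) ∪ -L)) =
        2 ^ Module.finrank ℝ (EuclideanSpace ℝ (Fin n)) *
          volume (K : Set (EuclideanSpace ℝ (Fin n))) *
          volume (L : Set (EuclideanSpace ℝ (Fin n))) := by
      rw [finrank_euclideanSpace_fin, heq]
    obtain rfl : K = L := SetLike.coe_injective (eq_of_measure_eq volume K.isCompact L.isCompact
      K.convex L.convex hK0 hL0 hK hL heq')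
    exact ⟨rfl, (fiberRigid_of_measure_eq volume K.isCompact K.isCompact K.convex K.convex hK0 hK0
      hK hK heq').1.isSimplexWithVertexZero K.isCompact K.convex hK0 hK⟩
  · rintro ⟨rfl, hS⟩
    refine le_antisymm (hle.trans hKL) ?_
    obtain ⟨b, hb⟩ := hS.exists_basis
    rw [Set.inter_self, mul_comm (volume (K : Set (EuclideanSpace ℝ (Fin n))))]
    refine mul_le_mul_left ?_ _
    rw [hb]
    exact two_pow_mul_measure_simplex_le volume b
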